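/- Let $k,l$ be coprime positive integers. Let $\mathrm{PU}(n)=\mathrm{U}(n)/\{e^{i\varphi}E_n\}$, and let $\mathrm{PU}(k)\otimes\mathrm{PU}(l)\subset\mathrm{PU}(kl)$ be the image of $\mathrm{PU}(k)\times\mathrm{PU}(l)$ under the Kronecker product of matrices. The matrix Grassmannian is the homogeneous space $$\mathrm{Gr}_{k,l}=\mathrm{PU}(kl)/(\mathrm{PU}(k)\otimes\mathrm{PU}(l));$$ the class $x$ of $u\in\mathrm{U}(kl)$ corresponds to the subalgebra $M_{k,x}=u\,(M_k(\mathbb{C})\otimes\mathbb{C}E_l)\,u^{*}\subset M_{kl}(\mathbb{C})$. Its tautological $M_k(\mathbb{C})$-bundle is $\mathcal{A}_{k,l}=\{(x,T)\mid T\in M_{k,x}\}\subset\mathrm{Gr}_{k,l}\times M_{kl}(\mathbb{C})$. Let $\mathrm{EPU}(k)\to\mathrm{BPU}(k)$ be any universal principal $\mathrm{PU}(k)$-bundle, that is, a locally trivial principal $\mathrm{PU}(k)$-bundle with contractible total space. Let $A_k^{univ}=\mathrm{EPU}(k)\times_{\mathrm{PU}(k)}M_k(\mathbb{C})$ be the universal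 $M_k(\mathbb{C})$-bundle, where $\mathrm{PU}(k)$ acts on $M_k(\mathbb{C})$ by conjugation. Let $\mathrm{Hom}(M_k(\mathbb{C}),M_{kl}(\mathbb{C}))$ be the space of all unital algebra homomorphisms, on which $g\in\mathrm{PU}(k)$ acts by $\vartheta\mapsto\vartheta\circ g^{-1}$, and let $$p\colon \mathbf{H}_{k,l}(A_k^{univ})=\mathrm{EPU}(k)\times_{\mathrm{PU}(k)}\mathrm{Hom}(M_k(\mathbb{C}),M_{kl}(\mathbb{C}))\to\mathrm{BPU}(k)$$ be the associated bundle, whose fibre over $b$ is $\mathrm{Hom}((A_k^{univ})_b,M_{kl}(\mathbb{C}))$. A continuous map $t\colon\mathrm{Gr}_{k,l}\to\mathrm{BPU}(k)$ is a classifying map for $\mathcal{A}_{k,l}$ if $t^{*}A_k^{univ}\cong\mathcal{A}_{k,l}$ as bundles of algebras over $\mathrm{Gr}_{k,l}$. **Theorem.** The total space $\mathbf{H}_{k,l}(A_k^{univ})$ is homotopy equivalent to $\mathrm{Gr}_{k,l}$, and under this equivalence the projection $p$ is identified with the classifying map $t_{k,l}$ of $\mathcal{A}_{k,l}$. More precisely,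 there is a homotopy equivalence $\varphi\colon\mathbf{H}_{k,l}(A_k^{univ})\to\mathrm{Gr}_{k,l}$, with homotopy inverse $\psi$, such that classifying maps for $\mathcal{A}_{k,l}$ exist, and every classifying map $t_{k,l}$ for $\mathcal{A}_{k,l}$ satisfies $t_{k,l}\circ\varphi\simeq p$ and $p\circ\psi\simeq t_{k,l}$. -/

import Mathlib

open scoped ContinuousMap

namespace FAB

noncomputable section

open Matrix
open scoped Kronecker

/-! ### Projective unitary groups -/

/-- The matrix algebra `M_k(ℂ)`. -/
abbrev Mat (k : ℕ) : Type := Matrix (Fin k) (Fin k) ℂ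

/-- The matrix algebra `M_{kl}(ℂ)`, with rows and columns indexed by pairs, so that it is the
target of the Kronecker product `M_k(ℂ) × M_l(ℂ) → M_{kl}(ℂ)`. -/
abbrev MatProd (k l : ℕ) : Type := Matrix (Fin k × Fin l) (Fin k × Fin l) ℂ

/-- The subgroup `{exp(iφ) E_n ∣ φ ∈ ℝ}` of the unitary group. -/
def scalarUnitary (n : Type) [Fintype n] [DecidableEq n] : Subgroup (unitaryGroup n ℂ) where
  carrier := {u | ∃ φ : ℝ, (u : Matrix n n ℂ) = Complex.exp (φ * Complex.I) • 1}
  one_mem' := ⟨0, by simp⟩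
  mul_mem' := by
    rintro u v ⟨φ, hu⟩ ⟨ψ, hv⟩
    refine ⟨φ + ψ, ?_⟩
    have h : ((u * v : unitaryGroup n ℂ) : Matrix n n ℂ) = (u : Matrix n n ℂ) * (v : Matrix n n ℂ) :=
      rfl
    rw [h, hu, hv, smul_mul_smul_comm, one_mul, Complex.ofReal_add, add_mul, Complex.exp_add]
  inv_mem' := by
    rintro u ⟨φ, hu⟩
    refine ⟨-φ, ?_⟩
    have h : ((u⁻¹ : unitaryGroup n ℂ) : Matrix n n ℂ) = star (u : Matrix n n ℂ) := rfl
    rw [h, hu, star_smul, star_one]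
    congr 1
    rw [Complex.star_def, ← Complex.exp_conj]
    simp

instance scalarUnitary_normal (n : Type) [Fintype n] [DecidableEq n] :
    (scalarUnitary n).Normal where
  conj_mem := by
    rintro u ⟨φ, hu⟩ g
    refine ⟨φ, ?_⟩
    have h : ((g * u * g⁻¹ : unitaryGroup n ℂ) : Matrix n n ℂ)
        = (g : Matrix n n ℂ) * (u : Matrix n n ℂ) * star (g : Matrix n n ℂ) := rfl
    rw [h, hu]
    simp

/-- The projective unitary group `PU(n) = U(n) / {exp(iφ) E_n}` with the quotient topology. -/
abbrev PU (n : Type) [Fintype n] [DecidableEq n] : Type :=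
  unitaryGroup n ℂ ⧸ scalarUnitary n

/-- The action of `PU(n)` on `M_n(ℂ)` by conjugation, `[u] ↦ (a ↦ u a u*)`. -/
def conjPU (n : Type) [Fintype n] [DecidableEq n] :
    PU n →* (Matrix n n ℂ ≃⋆ₐ[ℂ] Matrix n n ℂ) :=
  QuotientGroup.lift (scalarUnitary n) (Unitary.conjStarAlgAut ℂ (Matrix n n ℂ)) (by
    rintro u ⟨φ, hu⟩
    have hs : star (u : Matrix n n ℂ) * (u : Matrix n n ℂ) = 1 := Unitary.coe_star_mul_self u
    ext1 a
    change (u : Matrix n n ℂ) * a * star (u : Matrix n n ℂ) = a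
    have hc : (u : Matrix n n ℂ) * a = a * (u : Matrix n n ℂ) := by rw [hu]; simp
    have hs' : (u : Matrix n n ℂ) * star (u : Matrix n n ℂ) = 1 := Unitary.coe_mul_star_self u
    rw [hc, mul_assoc, hs', mul_one])

/-- `PU(k)` acts on `M_k(ℂ)` by conjugation. -/
instance matAction (k : ℕ) : MulAction (PU (Fin k)) (Mat k) where
  smul g a := conjPU (Fin k) g a
  one_smul a := by
    change conjPU (Fin k) 1 a = a
    rw [map_one]; rfl
  mul_smul g h a := by
    change conjPU (Fin k) (g * h) a = conjPU (Fin k) g (conjPU (Fin k) h a)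
    rw [map_mul]; rfl

/-! ### The space `Hom(M_k(ℂ), M_{kl}(ℂ))` -/

/-- The space of all unital homomorphisms of algebras `M_k(ℂ) → M_{kl}(ℂ)`. -/
def HomSpace (k l : ℕ) : Type := Mat k →ₐ[ℂ] MatProd k l

/-- The underlying homomorphism of algebras of a point of `HomSpace k l`. -/
def HomSpace.toAlgHom {k l : ℕ} (h : HomSpace k l) : Mat k →ₐ[ℂ] MatProd k l := h

/-- The topology of a subset of the finite-dimensional space of linear maps, that is, the topology
of pointwise convergence. -/
instance homSpaceTopology (k l : ℕ) : TopologicalSpace (HomSpace k l) :=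
  TopologicalSpace.induced (fun h (a : Mat k) => h.toAlgHom a) inferInstance

/-- `PU(k)` acts on `Hom(M_k(ℂ), M_{kl}(ℂ))` by `(g, ϑ) ↦ ϑ ∘ g⁻¹`. -/
instance homAction (k l : ℕ) : MulAction (PU (Fin k)) (HomSpace k l) where
  smul g h := h.toAlgHom.comp ((conjPU (Fin k) g⁻¹).toAlgEquiv : Mat k →ₐ[ℂ] Mat k)
  one_smul h := by
    change h.toAlgHom.comp ((conjPU (Fin k) 1⁻¹).toAlgEquiv : Mat k →ₐ[ℂ] Mat k) = h.toAlgHom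
    rw [inv_one, map_one]; rfl
  mul_smul g g' h := by
    change h.toAlgHom.comp ((conjPU (Fin k) (g * g')⁻¹).toAlgEquiv : Mat k →ₐ[ℂ] Mat k)
      = (h.toAlgHom.comp ((conjPU (Fin k) g'⁻¹).toAlgEquiv : Mat k →ₐ[ℂ] Mat k)).comp
        ((conjPU (Fin k) g⁻¹).toAlgEquiv : Mat k →ₐ[ℂ] Mat k)
    rw [_root_.mul_inv_rev, map_mul]; rfl

/-! ### The matrix Grassmannian and its tautological bundle -/

/-- The homomorphism `U(k) × U(l) → U(kl)` given by the Kronecker product. -/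
def kroneckerHom (k l : ℕ) :
    unitaryGroup (Fin k) ℂ × unitaryGroup (Fin l) ℂ →* unitaryGroup (Fin k × Fin l) ℂ where
  toFun p := ⟨(p.1 : Mat k) ⊗ₖ (p.2 : Mat l), kronecker_mem_unitary p.1.2 p.2.2⟩
  map_one' := by
    apply Subtype.ext
    simp
  map_mul' p q := by
    apply Subtype.ext
    simp [mul_kronecker_mul]

/-- The subgroup `PU(k) ⊗ PU(l)` of `PU(kl)`: the classes of the matrices `a ⊗ b` with
`a ∈ U(k)` and `b ∈ U(l)`. -/
def tensorSubgroup (k l : ℕ) : Subgroup (PU (Fin k × Fin l)) :=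
  ((QuotientGroup.mk' (scalarUnitary (Fin k × Fin l))).comp (kroneckerHom k l)).range

/-- The matrix Grassmannian `Gr_{k,l} = PU(kl) / (PU(k) ⊗ PU(l))` with the quotient topology. -/
abbrev Gr (k l : ℕ) : Type := PU (Fin k × Fin l) ⧸ tensorSubgroup k l

/-- The point of `Gr_{k,l}` that corresponds to the subalgebra `u (M_k(ℂ) ⊗ ℂE_l) u*`. -/
def Gr.mk {k l : ℕ} (u : unitaryGroup (Fin k × Fin l) ℂ) : Gr k l :=
  QuotientGroup.mk (QuotientGroup.mk u : PU (Fin k × Fin l))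

/-- The total space `{(x, T) ∣ T ∈ M_{k,x}} ⊆ Gr_{k,l} × M_{kl}(ℂ)` of the tautological
`M_k(ℂ)`-bundle, where `M_{k,x} = u (M_k(ℂ) ⊗ ℂE_l) u*` if `x` is the class of `u`. -/
def Taut (k l : ℕ) : Set (Gr k l × MatProd k l) :=
  {p | ∃ u : unitaryGroup (Fin k × Fin l) ℂ, Gr.mk u = p.1 ∧
    ∃ a : Mat k, p.2 = (u : MatProd k l) * (a ⊗ₖ (1 : Mat l)) * star (u : MatProd k l)}

/-! ### Principal bundles and associated bundles -/

/-- `π : E → B` is a (locally trivial) principal `G`-bundle. The group acts on the left; a right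
action is turned into a left one by `g • e = e · g⁻¹`. -/
structure IsPrincipalBundle (G : Type*) [Group G] [TopologicalSpace G]
    {E B : Type*} [TopologicalSpace E] [TopologicalSpace B] [MulAction G E] (π : C(E, B)) :
    Prop where
  continuous_smul : Continuous fun p : G × E => p.1 • p.2
  proj_smul : ∀ (g : G) (e : E), π (g • e) = π e
  exists_trivialization : ∀ b : B, ∃ Φ : Bundle.Trivialization G (π : E → B),
    b ∈ Φ.baseSet ∧ ∀ (g : G) (e : E), π e ∈ Φ.baseSet → (Φ (g • e)).2 = g * (Φ e).2

/-- A universal principal `G`-bundle `E = EG → B = BG`: one whose total space is contractible. -/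
structure IsUniversalBundle (G : Type*) [Group G] [TopologicalSpace G]
    {E B : Type*} [TopologicalSpace E] [TopologicalSpace B] [MulAction G E] (π : C(E, B)) : Prop
    extends IsPrincipalBundle G π where
  contractible : ContractibleSpace E

/-- The total space `E ×_G F = (E × F) / ((e, f) ∼ (g e, g f))` of the associated bundle with
fibre `F`, with the quotient topology. -/
abbrev Assoc (G E F : Type*) [Group G] [MulAction G E] [MulAction G F] :=
  MulAction.orbitRel.Quotient G (E × F)

/-- The class `[e, f]` in `E ×_G F`. -/
def Assoc.mk (G : Type*) {E F : Type*} [Group G] [MulAction G E] [MulAction G F]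
    (e : E) (f : F) : Assoc G E F :=
  Quotient.mk (MulAction.orbitRel G (E × F)) (e, f)

/-- The projection `E ×_G F → B`, `[e, f] ↦ π e`. -/
def Assoc.proj {G E B : Type*} (F : Type*) [Group G] [TopologicalSpace G]
    [TopologicalSpace E] [TopologicalSpace B] [TopologicalSpace F]
    [MulAction G E] [MulAction G F] {π : C(E, B)} (hπ : IsPrincipalBundle G π) :
    C(Assoc G E F, B) where
  toFun := Quotient.lift (fun p : E × F => π p.1) (by
    rintro p q ⟨g, rfl⟩
    exact hπ.proj_smul g q.1)
  continuous_toFun := Continuous.quotient_lift (π.continuous.comp continuous_fst) _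

/-! ### The bundles over `BPU(k)` -/

/-- The total space of the universal `M_k(ℂ)`-bundle `A_k^univ = EPU(k) ×_{PU(k)} M_k(ℂ)`. -/
abbrev AUniv (k : ℕ) (E : Type*) [MulAction (PU (Fin k)) E] :=
  Assoc (PU (Fin k)) E (Mat k)

/-- The total space of the `Hom(M_k(ℂ), M_{kl}(ℂ))`-bundle
`H_{k,l}(A_k^univ) = EPU(k) ×_{PU(k)} Hom(M_k(ℂ), M_{kl}(ℂ))`. -/
abbrev HUniv (k l : ℕ) (E : Type*) [MulAction (PU (Fin k)) E] :=
  Assoc (PU (Fin k)) E (HomSpace k l)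

/-- `t : Gr_{k,l} → BPU(k)` is a classifying map of the tautological bundle: there is an
isomorphism `Θ : t^*(A_k^univ) ≅ 𝒜_{k,l}` of bundles of algebras over `Gr_{k,l}`, that is, a
homeomorphism over `Gr_{k,l}` which is a homomorphism of algebras on every fibre. Here the fibre of
`A_k^univ` over `π e` carries the algebra structure transported from `M_k(ℂ)` along
`a ↦ [e, a]`. -/
def IsClassifyingMap {k l : ℕ} {E B : Type*} [TopologicalSpace E] [TopologicalSpace B]
    [MulAction (PU (Fin k)) E] {π : C(E, B)} (hπ : IsPrincipalBundle (PU (Fin k)) π)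
    (t : C(Gr k l, B)) : Prop :=
  ∃ Θ : {q : Gr k l × AUniv k E // Assoc.proj (Mat k) hπ q.2 = t q.1} ≃ₜ Taut k l,
    (∀ q, (Θ q).1.1 = q.1.1) ∧
    ∀ (x : Gr k l) (e : E) (he : π e = t x), ∃ θ : Mat k →ₐ[ℂ] MatProd k l,
      ∀ a : Mat k, (Θ ⟨(x, Assoc.mk (PU (Fin k)) e a), he⟩).1.2 = θ a

end

end FAB

/-! Write Fr for the space `StarHom k l` of star-preserving homomorphisms. Every such homomorphism
is `a ↦ u (a ⊗ E) u*` with `u` unitary, and two of them have the same image exactly when they differ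
by an element of PU(k); hence Fr/PU(k) = Gr, and Fr → Gr is the principal bundle whose associated
M_k(ℂ)-bundle is the tautological one. Moreover Hom(M_k, M_kl) retracts PU(k)-equivariantly onto Fr:
conjugating `h` by the square root of T = ∑ h(e_ij)* h(e_ij) makes it star-preserving. Since E is
contractible, E ×_G Hom ≃ E ×_G Fr ≃ Fr/G = Gr for G = PU(k).

The second equivalence rests on one principle: equivariant maps from a finitely numerated principal
G-space to a contractible G-space exist and are unique up to equivariant homotopy
(`exists_equivariant`, `exists_equivariant_homotopy`). An equivariant f : Fr → E gives ψ[h] = [f h,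
h], inverse to φ[e, h] = [h.toStar]. Here φψ = id on the nose, and ψφ ≃ id because (e, h) ↦ e and
(e, h) ↦ f(h.toStar) are equivariantly homotopic (`homotopic_id`).

The composite pψ sends [h] to π(f h) and is a classifying map, since the pulled back bundle and the
tautological bundle are quotients of Fr × M_k by the same relation
(`isClassifyingMap_of_equivariant`). If t is any classifying map, its algebra isomorphism turns the
points of t*E into homomorphisms onto the subalgebras M_{k,x}; after `toStar` this is an equivariant
map t*E → Fr over Gr, and uniqueness of equivariant maps t*E → E gives t ≃ pψ
(`IsClassifyingMap.homotopic`).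

The remaining work is local triviality of Fr → Gr (`exists_finiteTriv`). For h given by `u` and a
base point `v`, regard w = v*u in M_k ⊗ M_l as a linear map R into M_k. If h and v have the same
image then w = a ⊗ b, R has rank one and its range is spanned by the unitary a. In general R R*
depends only on h and has trace kl, so at most one eigenvalue exceeds 2kl/3. Truncating there leaves
at most a line in M_k, depending continuously on h; where it is spanned by an invertible matrix, the
polar part of that matrix is an equivariant coordinate in PU(k). -/

namespace FAB

noncomputable section

open Matrix Topology Set
open scoped Kronecker

/-! ### Equivariant maps into a contractible space -/

/-- A finite family of equivariant local trivialisations of a space `Y` with a partial action of `G`,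
encoded by the relation `Rel g y y'` (to be read `y' = g y`), which is numerated by
the functions `τ i`. -/
structure FiniteTriv (G Y : Type*) [Group G] [TopologicalSpace G] [TopologicalSpace Y]
    (Rel : G → Y → Y → Prop) (ι : Type*) where
  τ : ι → Y → ℝ
  γ : ι → Y → G
  continuous_τ : ∀ i, Continuous (τ i)
  continuousOn_γ : ∀ i, ContinuousOn (γ i) {y | 0 < τ i y}
  τ_inv : ∀ i g y y', Rel g y y' → τ i y' = τ i y
  γ_equiv : ∀ i g y y', Rel g y y' → 0 < τ i y → γ i y' = g * γ i y
  cover : ∀ y, ∃ i, 1 ≤ τ i y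

section Extension

variable {G E Y : Type*} [Group G] [TopologicalSpace G] [IsTopologicalGroup G]
  [TopologicalSpace E] [MulAction G E] [ContinuousSMul G E] [TopologicalSpace Y]

/-- Extension of an equivariant map over one further trivialising set. -/
theorem extend_step [ContractibleSpace E] {Rel : G → Y → Y → Prop} {σ ρ : Y → ℝ}
    (hσ : Continuous σ) (hρ : Continuous ρ)
    (σ_inv : ∀ g y y', Rel g y y' → σ y' = σ y) (ρ_inv : ∀ g y y', Rel g y y' → ρ y' = ρ y)
    {γ : Y → G} (hγ : ContinuousOn γ {y | 0 < ρ y})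
    (γ_equiv : ∀ g y y', Rel g y y' → 0 < ρ y → γ y' = g * γ y)
    {c c' : ℝ} (hc : c < c') {f : Y → E} (hf : ContinuousOn f {y | c < σ y})
    (f_equiv : ∀ g y y', Rel g y y' → c < σ y → f y' = g • f y) :
    ∃ f' : Y → E, ContinuousOn f' {y | c' < σ y ∨ 0 < ρ y} ∧
      (∀ g y y', Rel g y y' → (c' < σ y ∨ 0 < ρ y) → f' y' = g • f' y) ∧
      ∀ y, c' < σ y → f' y = f y := by
  obtain ⟨e₀, ⟨C⟩⟩ := id_nullhomotopic E
  -- A cut-off equal to 0 for `σ ≥ c'` and already equal to 1 for `σ ≤ (c + c') / 2`; the margin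
  -- above `c` lets `f` be forgotten before its domain ends.
  set lam : Y → unitInterval := fun y => Set.projIcc 0 1 zero_le_one ((c' - σ y) / ((c' - c) / 2))
    with hlam
  have lam_cont : Continuous lam := continuous_projIcc.comp (by fun_prop)
  have hd : 0 < (c' - c) / 2 := by linarith
  have lam0 : ∀ y, c' ≤ σ y → lam y = 0 := fun y hy => by
    apply Set.projIcc_of_le_left
    exact div_nonpos_of_nonpos_of_nonneg (by linarith) hd.le
  have lam1 : ∀ y, σ y ≤ (c + c') / 2 → lam y = 1 := fun y hy => by
    apply Set.projIcc_of_right_le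
    rw [le_div_iff₀ hd]; linarith
  have lam_inv : ∀ g y y', Rel g y y' → lam y' = lam y := fun g y y' h => by
    simp only [hlam, σ_inv g y y' h]
  have C0 : ∀ e, C (0, e) = e := fun e => by simp
  have C1 : ∀ e, C (1, e) = e₀ := fun e => by simp
  classical
  -- The point `(γ y)⁻¹ • f y` is invariant, so contracting it and moving back by `γ y` preserves
  -- equivariance. Where `lam = 1` the value is `γ y • e₀`, which no longer involves `f`; this gives
  -- continuity outside `{c < σ}`.
  let F : Y → E := fun y => γ y • C (lam y, (γ y)⁻¹ • f y)
  let f' : Y → E := fun y => if 0 < ρ y then F y else f y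
  have Feq : ∀ y, c' ≤ σ y → F y = f y := fun y hy => by
    simp only [F, lam0 y hy, C0, smul_inv_smul]
  have f'eq : ∀ y, c' < σ y → f' y = f y := fun y hy => by
    simp only [f']; split_ifs
    · exact Feq y hy.le
    · rfl
  have f'pos : ∀ y, 0 < ρ y → f' y = F y := fun y hy => if_pos hy
  have oρ : IsOpen {y | 0 < ρ y} := isOpen_lt continuous_const hρ
  refine ⟨f', ?_, ?_, f'eq⟩
  · rintro y hy
    apply ContinuousAt.continuousWithinAt
    rcases hy with hy | hy
    · have o : IsOpen {y | c' < σ y} := isOpen_lt continuous_const hσ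
      refine ContinuousAt.congr (f := f) ?_ ?_
      · exact hf.continuousAt (IsOpen.mem_nhds (isOpen_lt continuous_const hσ) (hc.trans hy))
      · filter_upwards [o.mem_nhds hy] with z hz using (f'eq z hz).symm
    · have hγy : ContinuousAt γ y := hγ.continuousAt (oρ.mem_nhds hy)
      refine ContinuousAt.congr (f := F) ?_ ?_
      · rcases lt_or_ge c (σ y) with h | h
        · have hfy : ContinuousAt f y :=
            hf.continuousAt (IsOpen.mem_nhds (isOpen_lt continuous_const hσ) h)
          exact hγy.smul (C.continuous.continuousAt.comp
            (lam_cont.continuousAt.prodMk (hγy.inv.smul hfy)))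
        · have h' : σ y < (c + c') / 2 := by linarith
          refine ContinuousAt.congr (f := fun y => γ y • e₀) (hγy.smul continuousAt_const) ?_
          filter_upwards [(isOpen_lt hσ continuous_const).mem_nhds h'] with z hz
          simp only [F, lam1 z (le_of_lt hz), C1]
      · filter_upwards [oρ.mem_nhds hy] with z hz using (f'pos z hz).symm
  · intro g y y' h hy
    by_cases hr : 0 < ρ y
    · rw [f'pos y hr, f'pos y' (by rwa [ρ_inv g y y' h])]
      simp only [F, lam_inv g y y' h, γ_equiv g y y' h hr]
      rcases lt_or_ge c (σ y) with hs | hs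
      · rw [f_equiv g y y' h hs, mul_smul, _root_.mul_inv_rev, mul_smul, inv_smul_smul]
      · rw [lam1 y (by linarith), C1, C1, mul_smul]
    · have hs := hy.resolve_right hr
      rw [f'eq y hs, f'eq y' (by rwa [σ_inv g y y' h]), f_equiv g y y' h (hc.trans hs)]

/-- An equivariant map into a contractible space that is given on the invariant open
set `{σ > 0}` can be extended equivariantly without changing it on `{σ ≥ 1}`. -/
theorem exists_extension [ContractibleSpace E] {Rel : G → Y → Y → Prop} {ι : Type*} [Finite ι]
    (D : FiniteTriv G Y Rel ι) {σ : Y → ℝ} (hσ : Continuous σ)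
    (σ_inv : ∀ g y y', Rel g y y' → σ y' = σ y) {f : Y → E}
    (hf : ContinuousOn f {y | 0 < σ y})
    (f_equiv : ∀ g y y', Rel g y y' → 0 < σ y → f y' = g • f y) :
    ∃ F : C(Y, E), (∀ g y y', Rel g y y' → F y' = g • F y) ∧ ∀ y, 1 ≤ σ y → F y = f y := by
  classical
  have := Fintype.ofFinite ι
  -- Induction over the trivialising sets. Each step raises the threshold `c` to `(c + 1) / 2`,
  -- still below 1, so the values on `{1 ≤ σ}` survive, and at the end every point lies above the
  -- threshold because some `τ i` is at least 1 there.
  have key : ∀ s : Finset ι, ∃ σ' : Y → ℝ, Continuous σ' ∧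
      (∀ g y y', Rel g y y' → σ' y' = σ' y) ∧ (∀ y, σ y ≤ σ' y) ∧ (∀ i ∈ s, ∀ y, D.τ i y ≤ σ' y) ∧
      ∃ c : ℝ, 0 ≤ c ∧ c < 1 ∧ ∃ f' : Y → E, ContinuousOn f' {y | c < σ' y} ∧
        (∀ g y y', Rel g y y' → c < σ' y → f' y' = g • f' y) ∧ ∀ y, 1 ≤ σ y → f' y = f y := by
    intro s
    induction s using Finset.induction_on with
    | empty => exact ⟨σ, hσ, σ_inv, fun _ => le_rfl, by simp, 0, le_rfl, one_pos, f, hf, f_equiv,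
        fun _ _ => rfl⟩
    | insert i s _ ih =>
      obtain ⟨σ', h1, h2, h3, h4, c, hc0, hc1, f', h5, h6, h7⟩ := ih
      obtain ⟨f'', k1, k2, k3⟩ := extend_step h1 (D.continuous_τ i) h2 (D.τ_inv i)
        (D.continuousOn_γ i) (D.γ_equiv i) (show c < (c + 1) / 2 by linarith) h5 h6
      have hsub : ∀ y, (c + 1) / 2 < max (σ' y) (D.τ i y) → (c + 1) / 2 < σ' y ∨ 0 < D.τ i y := by
        intro y hy
        rcases lt_max_iff.1 hy with h | h
        · exact Or.inl h
        · exact Or.inr (by linarith)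
      refine ⟨fun y => max (σ' y) (D.τ i y), h1.max (D.continuous_τ i), ?_, ?_, ?_,
        (c + 1) / 2, by linarith, by linarith, f'', k1.mono hsub, ?_, ?_⟩
      · intro g y y' h
        simp only [h2 g y y' h, D.τ_inv i g y y' h]
      · exact fun y => (h3 y).trans (le_max_left _ _)
      · intro j hj y
        rcases Finset.mem_insert.1 hj with rfl | hj
        · exact le_max_right _ _
        · exact (h4 j hj y).trans (le_max_left _ _)
      · exact fun g y y' h hy => k2 g y y' h (hsub y hy)
      · intro y hy
        rw [k3 y (by linarith [h3 y]), h7 y hy]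
  obtain ⟨σ', -, -, -, h4, c, -, hc1, f', h5, h6, h7⟩ := key Finset.univ
  have hall : ∀ y, c < σ' y := fun y => by
    obtain ⟨i, hi⟩ := D.cover y
    linarith [h4 i (Finset.mem_univ i) y]
  refine ⟨⟨f', ?_⟩, fun g y y' h => h6 g y y' h (hall y), h7⟩
  rw [← continuousOn_univ]
  exact h5.mono fun y _ => hall y

/-- This is extension from the empty set: with `σ = 0` nothing is prescribed, and the starting map
is arbitrary. -/
theorem exists_equivariant [ContractibleSpace E] {Rel : G → Y → Y → Prop} {ι : Type*} [Finite ι]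
    (D : FiniteTriv G Y Rel ι) :
    ∃ F : C(Y, E), ∀ g y y', Rel g y y' → F y' = g • F y := by
  obtain ⟨e⟩ : Nonempty E := inferInstance
  obtain ⟨F, hF, -⟩ := exists_extension (E := E) D (σ := fun _ => 0) continuous_const
    (fun _ _ _ _ => rfl) (f := fun _ => e) continuousOn_const
    (fun _ _ _ _ h => absurd h (lt_irrefl _))
  exact ⟨F, hF⟩

/-- Two equivariant maps into a contractible space are equivariantly homotopic. -/
theorem exists_equivariant_homotopy [ContractibleSpace E] {Rel : G → Y → Y → Prop} {ι : Type*}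
    [Finite ι] (D : FiniteTriv G Y Rel ι) (f₀ f₁ : C(Y, E))
    (h₀ : ∀ g y y', Rel g y y' → f₀ y' = g • f₀ y)
    (h₁ : ∀ g y y', Rel g y y' → f₁ y' = g • f₁ y) :
    ∃ F : C(unitInterval × Y, E), (∀ y, F (0, y) = f₀ y) ∧ (∀ y, F (1, y) = f₁ y) ∧
      ∀ s g y y', Rel g y y' → F (s, y') = g • F (s, y) := by
  let Rel' : G → unitInterval × Y → unitInterval × Y → Prop :=
    fun g z z' => z'.1 = z.1 ∧ Rel g z.2 z'.2
  let D' : FiniteTriv G (unitInterval × Y) Rel' ι :=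
    { τ := fun i z => D.τ i z.2
      γ := fun i z => D.γ i z.2
      continuous_τ := fun i => (D.continuous_τ i).comp continuous_snd
      continuousOn_γ := fun i => (D.continuousOn_γ i).comp continuousOn_snd fun _ h => h
      τ_inv := fun i g z z' h => D.τ_inv i g _ _ h.2
      γ_equiv := fun i g z z' h => D.γ_equiv i g _ _ h.2
      cover := fun z => D.cover z.2 }
  classical
  -- The function `σ` is 1 at both ends of the interval and positive only for s < 1/4 or s > 3/4,
  -- away from the jump of `f` at 1/2.
  let σ : unitInterval × Y → ℝ := fun z => 2 * |2 * (z.1 : ℝ) - 1| - 1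
  have hσ : Continuous σ := by fun_prop
  let f : unitInterval × Y → E := fun z => if (z.1 : ℝ) < 1 / 2 then f₀ z.2 else f₁ z.2
  have hf : ContinuousOn f {z | 0 < σ z} := by
    intro z hz
    apply ContinuousAt.continuousWithinAt
    rcases lt_or_ge (z.1 : ℝ) (1 / 2) with h | h
    · refine ContinuousAt.congr (f := fun z => f₀ z.2) (by fun_prop) ?_
      filter_upwards [(isOpen_lt (f := fun z : unitInterval × Y => (z.1 : ℝ)) (by fun_prop)
        continuous_const).mem_nhds h] with w hw
      exact (if_pos hw).symm
    · have h' : 1 / 2 < (z.1 : ℝ) := by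
        refine lt_of_le_of_ne h fun h' => ?_
        simp only [σ, mem_ofPred_eq, ← h'] at hz
        norm_num at hz
      refine ContinuousAt.congr (f := fun z => f₁ z.2) (by fun_prop) ?_
      filter_upwards [(isOpen_lt (g := fun z : unitInterval × Y => (z.1 : ℝ)) continuous_const
        (by fun_prop)).mem_nhds h'] with w hw
      exact (if_neg (not_lt.2 (le_of_lt hw))).symm
  have hfe : ∀ g z z', Rel' g z z' → 0 < σ z → f z' = g • f z := by
    intro g z z' h _
    simp only [f, h.1]
    split_ifs
    · exact h₀ g _ _ h.2
    · exact h₁ g _ _ h.2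
  obtain ⟨F, hF, hF'⟩ := exists_extension (E := E) D' hσ
    (fun g z z' h => by simp only [σ, h.1]) (f := f) hf hfe
  refine ⟨F, fun y => ?_, fun y => ?_, fun s g y y' h => hF g _ _ ⟨rfl, h⟩⟩
  · rw [hF' _ (by norm_num [σ])]
    simp [f]
  · rw [hF' _ (by norm_num [σ])]
    norm_num [f]

/-- Pull-back of a family of trivialisations. -/
def FiniteTriv.comap {Y' ι : Type*} [TopologicalSpace Y'] {Rel : G → Y → Y → Prop}
    (D : FiniteTriv G Y Rel ι) {Rel' : G → Y' → Y' → Prop} (m : C(Y', Y))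
    (hm : ∀ g y y', Rel' g y y' → Rel g (m y) (m y')) : FiniteTriv G Y' Rel' ι where
  τ i y := D.τ i (m y)
  γ i y := D.γ i (m y)
  continuous_τ i := (D.continuous_τ i).comp m.continuous
  continuousOn_γ i := (D.continuousOn_γ i).comp m.continuous.continuousOn fun _ h => h
  τ_inv i g y y' h := D.τ_inv i g _ _ (hm g y y' h)
  γ_equiv i g y y' h := D.γ_equiv i g _ _ (hm g y y' h)
  cover y := D.cover (m y)

end Extension

open scoped MatrixOrder ComplexOrder

/-! ### Square roots and polar decomposition of matrices -/

section Polar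

variable {n : Type*} [Fintype n] [DecidableEq n]

section

open scoped Matrix.Norms.L2Operator

/-- The operator norm makes the matrices a C*-algebra, where the functional calculus is continuous;
it induces the entrywise topology used elsewhere. -/
theorem continuousOn_matrix_sqrt :
    ContinuousOn (CFC.sqrt : Matrix n n ℂ → Matrix n n ℂ) {a | 0 ≤ a} :=
  CFC.continuousOn_sqrt

theorem continuous_matrix_abs : Continuous (CFC.abs : Matrix n n ℂ → Matrix n n ℂ) :=
  CFC.continuous_abs

end

theorem continuousOn_matrix_inv :
    ContinuousOn (fun A : Matrix n n ℂ => A⁻¹) {A | IsUnit A} := by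
  intro A hA
  have hA' : A.det ≠ 0 := ((Matrix.isUnit_iff_isUnit_det A).1 hA).ne_zero
  apply ContinuousAt.continuousWithinAt
  simp only [Matrix.inv_def, Ring.inverse_eq_inv']
  have h1 : ContinuousAt (fun A : Matrix n n ℂ => A.det) A :=
    (continuous_id.matrix_det).continuousAt
  exact (h1.inv₀ hA').smul (continuous_id.matrix_adjugate).continuousAt

/-- The unitary factor in the polar decomposition of an invertible matrix. -/
def polarFactor (b : Matrix n n ℂ) : Matrix n n ℂ := b * (CFC.sqrt (star b * b))⁻¹

theorem isUnit_sqrt {T : Matrix n n ℂ} (hT : 0 ≤ T) (hT' : IsUnit T) : IsUnit (CFC.sqrt T) := by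
  have h := CFC.sqrt_mul_sqrt_self T hT
  rw [← h] at hT'
  exact isUnit_of_mul_isUnit_left hT'

theorem star_sqrt (T : Matrix n n ℂ) : star (CFC.sqrt T) = CFC.sqrt T :=
  (IsSelfAdjoint.of_nonneg (CFC.sqrt_nonneg T)).star_eq

theorem star_inv_of_star_eq {S : Matrix n n ℂ} (hS : star S = S) : star S⁻¹ = S⁻¹ := by
  rw [star_eq_conjTranspose] at hS ⊢
  rw [Matrix.conjTranspose_nonsing_inv, hS]

theorem polarFactor_mem {b : Matrix n n ℂ} (hb : IsUnit b) : polarFactor b ∈ unitaryGroup n ℂ := by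
  have hT : IsUnit (star b * b) := hb.star.mul hb
  have hS := isUnit_sqrt (star_mul_self_nonneg b) hT
  have hS' : IsUnit (CFC.sqrt (star b * b)).det := (Matrix.isUnit_iff_isUnit_det _).1 hS
  rw [Matrix.mem_unitaryGroup_iff', polarFactor]
  set S := CFC.sqrt (star b * b) with hSdef
  have hSS : S * S = star b * b := CFC.sqrt_mul_sqrt_self _ (star_mul_self_nonneg b)
  rw [star_mul, star_inv_of_star_eq (star_sqrt _), ← hSdef]
  calc S⁻¹ * star b * (b * S⁻¹) = S⁻¹ * (star b * b) * S⁻¹ := by simp only [mul_assoc]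
    _ = 1 := by rw [← hSS, ← mul_assoc, Matrix.nonsing_inv_mul _ hS', one_mul,
      Matrix.mul_nonsing_inv _ hS']

/-- Uniqueness of the polar decomposition; the later transformation rules follow by exhibiting a
suitable positive factor. -/
theorem polarFactor_mul {a p : Matrix n n ℂ} (ha : star a * a = 1) (hp : 0 ≤ p) (hp' : IsUnit p) :
    polarFactor (a * p) = a := by
  have hps : star p = p := (IsSelfAdjoint.of_nonneg hp).star_eq
  have h : star (a * p) * (a * p) = p * p := by
    rw [star_mul, hps, mul_assoc, ← mul_assoc (star a), ha, one_mul]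
  rw [polarFactor, h, CFC.sqrt_mul_self p hp, mul_assoc,
    Matrix.mul_nonsing_inv _ ((Matrix.isUnit_iff_isUnit_det _).1 hp'), mul_one]

theorem exists_polar {b : Matrix n n ℂ} (hb : IsUnit b) :
    ∃ p : Matrix n n ℂ, 0 ≤ p ∧ IsUnit p ∧ b = polarFactor b * p := by
  have hT : IsUnit (star b * b) := hb.star.mul hb
  have hS := isUnit_sqrt (star_mul_self_nonneg b) hT
  refine ⟨CFC.sqrt (star b * b), CFC.sqrt_nonneg _, hS, ?_⟩
  rw [polarFactor, mul_assoc, Matrix.nonsing_inv_mul _ ((Matrix.isUnit_iff_isUnit_det _).1 hS),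
    mul_one]

theorem continuousOn_polarFactor :
    ContinuousOn (polarFactor : Matrix n n ℂ → Matrix n n ℂ) {b | IsUnit b} := by
  have h1 : ContinuousOn (fun b : Matrix n n ℂ => CFC.sqrt (star b * b)) {b | IsUnit b} :=
    continuousOn_matrix_sqrt.comp (by fun_prop) fun b _ => star_mul_self_nonneg b
  exact continuousOn_id.mul (continuousOn_matrix_inv.comp h1 fun b hb =>
    isUnit_sqrt (star_mul_self_nonneg b) (IsUnit.mul (IsUnit.star hb) hb))

/-- Right translation of the polar factor by a unitary matrix. -/
theorem polarFactor_mul_unitary {b a : Matrix n n ℂ} (hb : IsUnit b) (ha : a ∈ unitaryGroup n ℂ) :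
    polarFactor (b * a) = polarFactor b * a := by
  obtain ⟨p, hp, hp', h⟩ := exists_polar hb
  have hu := Matrix.mem_unitaryGroup_iff'.1 (polarFactor_mem hb)
  have ha1 := Matrix.mem_unitaryGroup_iff'.1 ha
  have ha2 := Matrix.mem_unitaryGroup_iff.1 ha
  have key : b * a = polarFactor b * a * (star a * p * a) := by
    calc b * a = polarFactor b * p * a := by rw [← h]
      _ = polarFactor b * (a * star a) * p * a := by rw [ha2, mul_one]
      _ = _ := by simp only [mul_assoc]
  rw [key, polarFactor_mul]
  · rw [star_mul, mul_assoc, ← mul_assoc (star (polarFactor b)), hu, one_mul, ha1]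
  · exact star_left_conjugate_nonneg hp a
  · have hau : IsUnit a := IsUnit.of_mul_eq_one (star a) ha2
    exact (hau.star.mul hp').mul hau

/-- The polar factor of a scalar multiple. -/
theorem polarFactor_smul {b : Matrix n n ℂ} (hb : IsUnit b) {c : ℂ} (hc : c ≠ 0) :
    ∃ φ : ℝ, polarFactor (c • b) = Complex.exp (φ * Complex.I) • polarFactor b := by
  obtain ⟨p, hp, hp', h⟩ := exists_polar hb
  have hu := Matrix.mem_unitaryGroup_iff'.1 (polarFactor_mem hb)
  have hn : ((‖c‖ : ℝ) : ℂ) ≠ 0 := by simpa using hc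
  refine ⟨c.arg, ?_⟩
  have key : c • b = (Complex.exp (c.arg * Complex.I) • polarFactor b) * (((‖c‖ : ℝ) : ℂ) • p) := by
    rw [smul_mul_smul_comm, ← h, mul_comm (Complex.exp _), Complex.norm_mul_exp_arg_mul_I]
  rw [key, polarFactor_mul]
  · rw [star_smul, smul_mul_smul_comm, hu, Complex.star_def, ← Complex.exp_conj, ← Complex.exp_add]
    simp
  · exact smul_nonneg (by exact_mod_cast norm_nonneg c) hp
  · exact (isUnit_smul_iff (Units.mk0 _ hn) p).2 hp'

end Polar

/-! ### Making a homomorphism of matrix algebras star-preserving -/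

section Gram

variable {k : ℕ} {n : Type*} [Fintype n] [DecidableEq n]

theorem single_mul_eq_sum (i j : Fin k) (a : Mat k) :
    single i j (1 : ℂ) * a = ∑ m, a j m • single i m (1 : ℂ) := by
  ext p q
  simp only [Matrix.mul_apply, Matrix.sum_apply, Matrix.smul_apply, Matrix.single_apply]
  by_cases h : i = p <;> simp [h]

theorem mul_single_eq_sum (i j : Fin k) (a : Mat k) :
    a * single i j (1 : ℂ) = ∑ m, a m i • single m j (1 : ℂ) := by
  ext p q
  simp only [Matrix.mul_apply, Matrix.sum_apply, Matrix.smul_apply, Matrix.single_apply]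
  by_cases h : j = q <;> simp [h]

theorem sum_single_diag : ∑ i : Fin k, single i i (1 : ℂ) = (1 : Mat k) := by
  ext p q
  rw [Matrix.sum_apply, Matrix.one_apply]
  by_cases h : p = q
  · subst h
    simp [Matrix.single_apply]
  · rw [if_neg h]
    refine Finset.sum_eq_zero fun i _ => ?_
    rw [Matrix.single_apply, if_neg]
    rintro ⟨rfl, rfl⟩
    exact h rfl

/-- The positive matrix `∑ h(e_ij)* h(e_ij)`. -/
def gram (h : Mat k →ₐ[ℂ] Matrix n n ℂ) : Matrix n n ℂ :=
  ∑ i, ∑ j, star (h (single i j 1)) * h (single i j 1)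

variable (h : Mat k →ₐ[ℂ] Matrix n n ℂ)

/-- Since `e_ij a = ∑ a_jm e_im`, both sides equal `∑ a_jm h(e_ij)* h(e_im)`. In other words, for
the inner product defined by `gram h` the adjoint of `h a` is `h (star a)`. -/
theorem gram_mul (a : Mat k) : gram h * h a = star (h (star a)) * gram h := by
  have h1 : gram h * h a =
      ∑ i, ∑ j, ∑ m, a j m • (star (h (single i j 1)) * h (single i m 1)) := by
    simp only [gram, Finset.sum_mul, mul_assoc, ← map_mul, single_mul_eq_sum, map_sum, map_smul,
      Finset.mul_sum, Matrix.mul_smul]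
  have h2 : star (h (star a)) * gram h =
      ∑ i, ∑ j, ∑ m, a m j • (star (h (single i m 1)) * h (single i j 1)) := by
    simp only [gram, Finset.mul_sum, ← mul_assoc, ← star_mul, ← map_mul, single_mul_eq_sum,
      map_sum, map_smul, star_sum, Finset.sum_mul, star_smul, Matrix.smul_mul]
    simp [Matrix.star_apply]
  rw [h1, h2]
  exact Finset.sum_congr rfl fun i _ => Finset.sum_comm

theorem gram_nonneg : 0 ≤ gram h :=
  Finset.sum_nonneg fun _ _ => Finset.sum_nonneg fun _ _ => star_mul_self_nonneg _

/-- A vector killed by `gram h` is killed by every `h(e_ij)`, hence by `∑ h(e_ii) = 1`. -/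
theorem isUnit_gram : IsUnit (gram h) := by
  rw [← Matrix.mulVec_injective_iff_isUnit]
  have key : ∀ v, gram h *ᵥ v = 0 → v = 0 := by
    intro v hv
    have h0 : ∑ i, ∑ j, star (h (single i j 1) *ᵥ v) ⬝ᵥ (h (single i j 1) *ᵥ v) = 0 := by
      have : star v ⬝ᵥ (gram h *ᵥ v) = 0 := by rw [hv, dotProduct_zero]
      simpa only [gram, Matrix.sum_mulVec, dotProduct_sum, ← Matrix.mulVec_mulVec,
        star_eq_conjTranspose, Matrix.dotProduct_mulVec, ← Matrix.star_mulVec] using this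
    have h1 : ∀ i, h (single i i 1) *ᵥ v = 0 := by
      intro i
      have hnn : ∀ i j, 0 ≤ star (h (single i j 1) *ᵥ v) ⬝ᵥ (h (single i j 1) *ᵥ v) :=
        fun i j => dotProduct_star_self_nonneg _
      have h2 := (Finset.sum_eq_zero_iff_of_nonneg
        (fun i _ => Finset.sum_nonneg fun j _ => hnn i j)).1 h0 i (Finset.mem_univ _)
      have h3 := (Finset.sum_eq_zero_iff_of_nonneg (fun j _ => hnn i j)).1 h2 i (Finset.mem_univ _)
      exact dotProduct_star_self_eq_zero.1 h3
    have h2 : (h 1) *ᵥ v = 0 := by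
      rw [← sum_single_diag, map_sum, Matrix.sum_mulVec]
      exact Finset.sum_eq_zero fun i _ => h1 i
    simpa using h2
  intro v w hvw
  rw [← sub_eq_zero]
  apply key
  rw [Matrix.mulVec_sub, sub_eq_zero]
  exact hvw

/-- `gram` does not change under precomposition with the conjugation by a unitary matrix. -/
theorem gram_comp {w : Mat k} (hw : w ∈ unitaryGroup (Fin k) ℂ)
    (h' : Mat k →ₐ[ℂ] Matrix n n ℂ) (hh' : ∀ a, h' a = h (w * a * star w)) :
    gram h' = gram h := by
  have hww := Matrix.mem_unitaryGroup_iff.1 hw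
  -- For fixed j, left multiplication by `w` mixes the units e_ij unitarily, so the sum of squares
  -- does not change. The factor `star w` on the right is then carried across by `gram_mul` and
  -- cancels.
  have h1 : ∑ i, ∑ j, star (h (w * single i j 1)) * h (w * single i j 1) = gram h := by
    simp only [mul_single_eq_sum, map_sum, map_smul, star_sum, star_smul, Finset.sum_mul,
      Finset.mul_sum, smul_mul_smul_comm]
    have hc : ∀ m m', ∑ i, star (w m i) * w m' i = if m' = m then 1 else 0 := by
      intro m m'
      have := congrFun (congrFun hww m') m
      rw [Matrix.mul_apply, Matrix.one_apply] at this
      simpa [Matrix.star_apply, mul_comm] using this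
    calc _ = ∑ j, ∑ m, ∑ m', (∑ i, star (w m i) * w m' i) •
          (star (h (single m j 1)) * h (single m' j 1)) := by
          rw [Finset.sum_comm]
          refine Finset.sum_congr rfl fun j _ => ?_
          simp only [Finset.sum_smul]
          rw [Finset.sum_comm]
          exact (Finset.sum_congr rfl fun m' _ => Finset.sum_comm).trans Finset.sum_comm
      _ = ∑ j, ∑ m, star (h (single m j 1)) * h (single m j 1) := by
          simp only [hc, ite_smul, one_smul, zero_smul, Finset.sum_ite_eq', Finset.mem_univ,
            if_true]
      _ = gram h := by rw [gram, Finset.sum_comm]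
  have h2 : gram h' = star (h (star w)) *
      (∑ i, ∑ j, star (h (w * single i j 1)) * h (w * single i j 1)) * h (star w) := by
    simp only [gram, hh', map_mul, star_mul, Finset.mul_sum, Finset.sum_mul, mul_assoc]
  rw [h2, h1, mul_assoc, gram_mul, star_star, ← mul_assoc, ← star_mul, ← map_mul, hww, map_one,
    star_one, one_mul]

/-- Here e_ij* e_ij = e_jj, and each e_jj occurs k times. The square root is thus a scalar, so the
deformation fixes star-preserving homomorphisms. -/
theorem gram_of_star (hs : ∀ a, h (star a) = star (h a)) : gram h = (k : ℂ) • 1 := by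
  have : ∀ i j : Fin k, star (h (single i j 1)) * h (single i j 1) = h (single j j 1) := by
    intro i j
    rw [← hs, ← map_mul]
    congr 1
    rw [star_eq_conjTranspose, Matrix.conjTranspose_single]
    simp
  simp only [gram, this, ← map_sum, sum_single_diag, map_one]
  simp [Nat.cast_smul_eq_nsmul]

/-- Conjugation of a homomorphism by an invertible matrix. -/
def conjAlgHom (X : Matrix n n ℂ) (hX : IsUnit X) : Mat k →ₐ[ℂ] Matrix n n ℂ where
  toFun a := X * h a * X⁻¹
  map_one' := by
    rw [map_one, mul_one, Matrix.mul_nonsing_inv _ ((Matrix.isUnit_iff_isUnit_det _).1 hX)]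
  map_mul' a b := by
    have := Matrix.nonsing_inv_mul X ((Matrix.isUnit_iff_isUnit_det _).1 hX)
    calc X * h (a * b) * X⁻¹ = X * h a * (X⁻¹ * X) * h b * X⁻¹ := by
          rw [this, map_mul]; simp only [mul_assoc, one_mul]
      _ = _ := by simp only [mul_assoc]
  map_zero' := by simp
  map_add' a b := by simp [mul_add, add_mul]
  commutes' c := by
    rw [AlgHomClass.commutes, ← Algebra.commutes, mul_assoc,
      Matrix.mul_nonsing_inv _ ((Matrix.isUnit_iff_isUnit_det _).1 hX), mul_one]

/-- The matrices `(1 - s) E + s √(gram h)`. -/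
def interp (s : unitInterval) : Matrix n n ℂ :=
  ((1 - (s : ℝ) : ℝ) : ℂ) • 1 + ((s : ℝ) : ℂ) • CFC.sqrt (gram h)

theorem posDef_sqrt_gram : (CFC.sqrt (gram h)).PosDef :=
  ((CFC.sqrt_nonneg (gram h)).posSemidef.posDef_iff_isUnit).2
    (isUnit_sqrt (gram_nonneg h) (isUnit_gram h))

/-- A convex combination of the identity and a positive definite matrix is positive definite; s = 0
is separate because the second summand then vanishes. -/
theorem isUnit_interp (s : unitInterval) : IsUnit (interp h s) := by
  apply Matrix.PosDef.isUnit
  rcases s.2.1.eq_or_lt with hs | hs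
  · rw [interp, ← hs]
    simpa using Matrix.PosDef.one
  · rw [interp]
    refine Matrix.PosDef.posSemidef_add ?_ ?_
    · exact Matrix.PosSemidef.one.smul (by exact_mod_cast sub_nonneg.2 s.2.2)
    · exact (posDef_sqrt_gram h).smul (by exact_mod_cast hs)

/-- The deformation of a homomorphism to a star-preserving one. -/
def deform (s : unitInterval) : Mat k →ₐ[ℂ] Matrix n n ℂ :=
  conjAlgHom h (interp h s) (isUnit_interp h s)

theorem deform_apply (s : unitInterval) (a : Mat k) :
    deform h s a = interp h s * h a * (interp h s)⁻¹ := rfl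

theorem deform_zero : deform h 0 = h := by
  ext1 a
  simp [deform_apply, interp]

theorem interp_one : interp h 1 = CFC.sqrt (gram h) := by simp [interp]

/-- With S² = `gram h`, the relation S² h(a*) = h(a)* S² becomes S h(a*) S⁻¹ = S⁻¹ h(a)* S. -/
theorem deform_one_star (a : Mat k) : deform h 1 (star a) = star (deform h 1 a) := by
  rw [deform_apply, deform_apply, interp_one]
  set S := CFC.sqrt (gram h) with hS
  have hSS : S * S = gram h := CFC.sqrt_mul_sqrt_self _ (gram_nonneg h)
  have hSu : IsUnit S.det :=
    (Matrix.isUnit_iff_isUnit_det _).1 (isUnit_sqrt (gram_nonneg h) (isUnit_gram h))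
  have key : S * S * h (star a) = star (h a) * (S * S) := by
    rw [hSS, gram_mul, star_star]
  have e1 : S⁻¹ * S = 1 := Matrix.nonsing_inv_mul _ hSu
  have e2 : S * S⁻¹ = 1 := Matrix.mul_nonsing_inv _ hSu
  rw [star_mul, star_mul, star_inv_of_star_eq (star_sqrt _), star_sqrt, ← hS]
  calc S * h (star a) * S⁻¹ = S⁻¹ * S * S * h (star a) * S⁻¹ := by rw [e1, one_mul]
    _ = S⁻¹ * (S * S * h (star a)) * S⁻¹ := by simp only [mul_assoc]
    _ = S⁻¹ * (star (h a) * S) * (S * S⁻¹) := by rw [key]; simp only [mul_assoc]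
    _ = _ := by rw [e2, mul_one]

theorem deform_of_star (hs : ∀ a, h (star a) = star (h a)) (s : unitInterval) :
    deform h s = h := by
  have hk : (0 : ℂ) ≤ ((Real.sqrt k : ℝ) : ℂ) := by exact_mod_cast Real.sqrt_nonneg _
  have h1 : CFC.sqrt (gram h) = ((Real.sqrt k : ℝ) : ℂ) • 1 := by
    apply CFC.sqrt_unique
    · rw [smul_mul_smul_comm, one_mul, gram_of_star h hs, ← Complex.ofReal_mul,
        Real.mul_self_sqrt (Nat.cast_nonneg k), Complex.ofReal_natCast]
    · exact smul_nonneg hk zero_le_one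
  ext1 a
  have hc : interp h s * h a = h a * interp h s := by
    rw [interp, h1]; simp [mul_add, add_mul]
  rw [deform_apply, hc, mul_assoc,
    Matrix.mul_nonsing_inv _ ((Matrix.isUnit_iff_isUnit_det _).1 (isUnit_interp h s)), mul_one]

theorem deform_comp {w : Mat k} (hw : w ∈ unitaryGroup (Fin k) ℂ)
    (h' : Mat k →ₐ[ℂ] Matrix n n ℂ) (hh' : ∀ a, h' a = h (w * a * star w)) (s : unitInterval)
    (a : Mat k) : deform h' s a = deform h s (w * a * star w) := by
  rw [deform_apply, deform_apply, interp, interp, gram_comp h hw h' hh', hh']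

end Gram

/-! ### Star-preserving homomorphisms `M_k(ℂ) → M_{kl}(ℂ)` -/

/-- A Hermitian idempotent of trace `l` is of the form `J J*` for an isometry `J` defined
on `ℂ^l`. -/
theorem exists_isometry {n : Type*} [Fintype n] [DecidableEq n] {l : ℕ} {p : Matrix n n ℂ}
    (hp : p.IsHermitian) (hpp : p * p = p) (htr : p.trace = l) :
    ∃ J : Matrix n (Fin l) ℂ, Jᴴ * J = 1 ∧ J * Jᴴ = p := by
  set U : Matrix n n ℂ := (hp.eigenvectorUnitary : Matrix n n ℂ) with hU
  have hUU : star U * U = 1 := Unitary.coe_star_mul_self hp.eigenvectorUnitary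
  have hUU' : U * star U = 1 := Unitary.coe_mul_star_self hp.eigenvectorUnitary
  set D : Matrix n n ℂ := diagonal (fun i => ((hp.eigenvalues i : ℝ) : ℂ)) with hD
  have hspec : p = U * D * star U := by
    have := hp.spectral_theorem
    rw [Unitary.conjStarAlgAut_apply] at this
    exact this
  have hDD : D * D = D := by
    have h1 : D = star U * p * U := by
      rw [hspec]
      calc D = (star U * U) * D * (star U * U) := by rw [hUU]; simp
        _ = _ := by simp only [mul_assoc]
    calc D * D = star U * p * (U * star U) * p * U := by
          conv_lhs => rw [h1]
          simp only [mul_assoc]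
      _ = star U * (p * p) * U := by rw [hUU', mul_one]; simp only [mul_assoc]
      _ = D := by rw [hpp, ← h1]
  have hev : ∀ i, hp.eigenvalues i = 0 ∨ hp.eigenvalues i = 1 := by
    intro i
    have := congrFun (congrFun hDD i) i
    rw [hD, diagonal_mul_diagonal, diagonal_apply_eq, diagonal_apply_eq] at this
    have h2 : hp.eigenvalues i * hp.eigenvalues i = hp.eigenvalues i := by exact_mod_cast this
    rcases mul_eq_zero.1 (show hp.eigenvalues i * (hp.eigenvalues i - 1) = 0 by linarith) with h | h
    · exact Or.inl h
    · exact Or.inr (by linarith)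
  have hcard : Fintype.card {i // hp.eigenvalues i = 1} = l := by
    have h1 := hp.trace_eq_sum_eigenvalues
    rw [htr] at h1
    have h2 : (∑ i, hp.eigenvalues i) = (l : ℝ) := by
      have : ((l : ℝ) : ℂ) = ((∑ i, hp.eigenvalues i : ℝ) : ℂ) := by simpa using h1
      exact_mod_cast this.symm
    have h3 : ∑ i, hp.eigenvalues i = ∑ i, if hp.eigenvalues i = 1 then (1 : ℝ) else 0 := by
      refine Finset.sum_congr rfl fun i _ => ?_
      rcases hev i with h | h <;> simp [h]
    rw [h3, Finset.sum_boole] at h2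
    rw [Fintype.card_subtype]
    exact_mod_cast h2
  let e : Fin l ≃ {i // hp.eigenvalues i = 1} := (Fintype.equivFinOfCardEq hcard).symm
  -- The columns of `J` are the eigenvectors with eigenvalue 1; the trace says that there are l of
  -- them.
  refine ⟨U.submatrix id (fun j => (e j : n)), ?_, ?_⟩
  · ext j j'
    have := congrFun (congrFun hUU (e j)) (e j')
    rw [Matrix.one_apply] at this ⊢
    rw [Matrix.mul_apply] at this ⊢
    simpa [Subtype.ext_iff.symm] using this
  · refine Eq.trans ?_ hspec.symm
    ext r s
    rw [Matrix.mul_apply, Matrix.mul_apply]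
    have h1 : ∀ i, (U * D) r i * star U i s =
        if hp.eigenvalues i = 1 then U r i * star (U s i) else 0 := by
      intro i
      rw [hD, Matrix.mul_diagonal, Matrix.star_apply]
      rcases hev i with h | h <;> simp [h]
    simp only [h1]
    rw [← Finset.sum_filter, Finset.sum_subtype (Finset.univ.filter fun i => hp.eigenvalues i = 1)
      (p := fun i => hp.eigenvalues i = 1) (by simp)]
    exact Equiv.sum_comp e (fun x => U r x * star (U s x))

/-- The homomorphism `a ↦ u (a ⊗ E) u*`. -/
def conjHom {k l : ℕ} (u : unitaryGroup (Fin k × Fin l) ℂ) : HomSpace k l :=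
  AlgHom.ofLinearMap
    { toFun := fun a => (u : MatProd k l) * (a ⊗ₖ (1 : Mat l)) * star (u : MatProd k l)
      map_add' := fun a b => by rw [Matrix.add_kronecker, mul_add, add_mul]
      map_smul' := fun c a => by
        rw [Matrix.smul_kronecker, Matrix.mul_smul, Matrix.smul_mul, RingHom.id_apply] }
    (by
      change (u : MatProd k l) * ((1 : Mat k) ⊗ₖ (1 : Mat l)) * star (u : MatProd k l) = 1
      rw [Matrix.one_kronecker_one, mul_one]
      exact Unitary.coe_mul_star_self u)
    (fun a b => by
      have hu : star (u : MatProd k l) * (u : MatProd k l) = 1 := Unitary.coe_star_mul_self u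
      change (u : MatProd k l) * ((a * b) ⊗ₖ (1 : Mat l)) * star (u : MatProd k l) =
        (u : MatProd k l) * (a ⊗ₖ (1 : Mat l)) * star (u : MatProd k l) *
          ((u : MatProd k l) * (b ⊗ₖ (1 : Mat l)) * star (u : MatProd k l))
      calc _ = (u : MatProd k l) * ((a ⊗ₖ (1 : Mat l)) * (b ⊗ₖ (1 : Mat l))) *
            star (u : MatProd k l) := by rw [← Matrix.mul_kronecker_mul, mul_one]
        _ = (u : MatProd k l) * (a ⊗ₖ (1 : Mat l)) * (star (u : MatProd k l) *
          (u : MatProd k l)) * (b ⊗ₖ (1 : Mat l)) * star (u : MatProd k l) := by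
            rw [hu, mul_one]; simp only [mul_assoc]
        _ = _ := by simp only [mul_assoc])

variable {k l : ℕ}

theorem conjHom_apply (u : unitaryGroup (Fin k × Fin l) ℂ) (a : Mat k) :
    (conjHom u).toAlgHom a =
      (u : MatProd k l) * (a ⊗ₖ (1 : Mat l)) * star (u : MatProd k l) := rfl

theorem HomSpace.ext {h h' : HomSpace k l} (H : ∀ a, h.toAlgHom a = h'.toAlgHom a) : h = h' :=
  AlgHom.ext H

/-- A homomorphism that commutes with the involutions. -/
def HomSpace.IsStar (h : HomSpace k l) : Prop :=
  ∀ a, h.toAlgHom (star a) = star (h.toAlgHom a)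

theorem star_kronecker_one (a : Mat k) : star (a ⊗ₖ (1 : Mat l)) = (star a) ⊗ₖ (1 : Mat l) := by
  simp [star_eq_conjTranspose, Matrix.conjTranspose_kronecker]

theorem isStar_conjHom (u : unitaryGroup (Fin k × Fin l) ℂ) : (conjHom u).IsStar := by
  intro a
  rw [conjHom_apply, conjHom_apply, star_mul, star_mul, star_star, star_kronecker_one, mul_assoc]

/-- The projections h(e_ii) are pairwise conjugate via the h(e_ij), so each has trace l. An isometry
`J` of ℂ^l onto the range of h(e_00) is spread to the other blocks: `u` sends e_i ⊗ x to h(e_i0) J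
x. -/
theorem exists_conjHom_eq (hk : 0 < k) {h : HomSpace k l} (hs : h.IsStar) :
    ∃ u, conjHom u = h := by
  set H := h.toAlgHom with hH
  have hsH : ∀ a, H (star a) = star (H a) := hs
  let i0 : Fin k := ⟨0, hk⟩
  have hstar : ∀ i j : Fin k, star (H (single i j 1)) = H (single j i 1) := fun i j => by
    rw [← hsH, star_eq_conjTranspose, Matrix.conjTranspose_single, star_one]
  have hmul : ∀ i j m : Fin k, H (single i j 1) * H (single j m 1) = H (single i m 1) :=
    fun i j m => by rw [← map_mul, Matrix.single_mul_single_same, mul_one]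
  have hmul0 : ∀ i j j' m : Fin k, j ≠ j' → H (single i j 1) * H (single j' m 1) = 0 :=
    fun i j j' m hj => by rw [← map_mul, Matrix.single_mul_single_of_ne _ _ _ _ hj, map_zero]
  have htr : (H (single i0 i0 1)).trace = l := by
    have h1 : ∀ i, (H (single i i 1)).trace = (H (single i0 i0 1)).trace := fun i => by
      rw [← hmul i i0 i, Matrix.trace_mul_comm, hmul]
    have h2 : (H 1).trace = (k : ℂ) * (H (single i0 i0 1)).trace := by
      rw [← sum_single_diag, map_sum, Matrix.trace_sum]
      simp [h1]
    rw [map_one, Matrix.trace_one, Fintype.card_prod, Fintype.card_fin, Fintype.card_fin,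
      Nat.cast_mul] at h2
    exact (mul_left_cancel₀ (Nat.cast_ne_zero.2 hk.ne') h2).symm
  obtain ⟨J, hJ1, hJ2⟩ := exists_isometry (p := H (single i0 i0 1)) (hstar i0 i0) (hmul _ _ _) htr
  let u : MatProd k l := Matrix.of fun r q => (H (single q.1 i0 1) * J) r q.2
  have huu : star u * u = 1 := by
    ext ⟨i, j⟩ ⟨i', j'⟩
    have h1 : (star u * u) (i, j) (i', j') =
        ((H (single i i0 1) * J)ᴴ * (H (single i' i0 1) * J)) j j' := by
      rw [Matrix.mul_apply, Matrix.mul_apply]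
      rfl
    have h2 : (H (single i i0 1) * J)ᴴ * (H (single i' i0 1) * J) = if i = i' then 1 else 0 := by
      rw [Matrix.conjTranspose_mul, ← star_eq_conjTranspose (H _), hstar, Matrix.mul_assoc,
        ← Matrix.mul_assoc (H _)]
      split_ifs with hi
      · subst hi
        rw [hmul, ← hJ2, Matrix.mul_assoc, hJ1, Matrix.mul_one, hJ1]
      · rw [hmul0 _ _ _ _ hi, Matrix.zero_mul, Matrix.mul_zero]
    rw [h1, h2, Matrix.one_apply]
    by_cases hi : i = i' <;> simp [hi, Matrix.one_apply]
  have hu : u ∈ unitaryGroup (Fin k × Fin l) ℂ := Matrix.mem_unitaryGroup_iff'.2 huu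
  have huu' : u * star u = 1 := Matrix.mem_unitaryGroup_iff.1 hu
  refine ⟨⟨u, hu⟩, HomSpace.ext fun a => ?_⟩
  rw [conjHom_apply]
  change u * (a ⊗ₖ (1 : Mat l)) * star u = H a
  have key : H a * u = u * (a ⊗ₖ (1 : Mat l)) := by
    ext r ⟨i, j⟩
    have h1 : (H a * u) r (i, j) = (H (a * single i i0 1) * J) r j := by
      rw [map_mul, Matrix.mul_assoc]
      simp only [Matrix.mul_apply, u, Matrix.of_apply]
    rw [h1, mul_single_eq_sum, map_sum, Matrix.sum_mul, Matrix.sum_apply, Matrix.mul_apply,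
      Fintype.sum_prod_type]
    refine Finset.sum_congr rfl fun m _ => ?_
    rw [map_smul, Matrix.smul_mul, Matrix.smul_apply]
    simp [u, Matrix.one_apply, mul_comm]
  rw [← key, mul_assoc, huu', mul_one]

/-- The commutant of `M_k(ℂ) ⊗ ℂE_l`. -/
theorem exists_eq_one_kronecker (hk : 0 < k) {v : MatProd k l}
    (hv : ∀ a : Mat k, v * (a ⊗ₖ (1 : Mat l)) = (a ⊗ₖ (1 : Mat l)) * v) :
    ∃ b : Mat l, v = (1 : Mat k) ⊗ₖ b := by
  let i0 : Fin k := ⟨0, hk⟩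
  refine ⟨Matrix.of fun s t => v (i0, s) (i0, t), ?_⟩
  -- Commutation with e_pq, read in block row p and block column q': the diagonal blocks of `v`
  -- agree and the others vanish.
  have key : ∀ (p q q' : Fin k) (s t : Fin l),
      (if q = q' then v (p, s) (p, t) else 0) = v (q, s) (q', t) := by
    intro p q q' s t
    have h := congrFun (congrFun (hv (single p q 1)) (p, s)) (q', t)
    rw [Matrix.mul_apply, Matrix.mul_apply, Fintype.sum_prod_type, Fintype.sum_prod_type] at h
    simp only [Matrix.kronecker_apply, Matrix.single_apply, Matrix.one_apply] at h
    simpa [Finset.sum_ite_eq, ite_and] using h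
  ext ⟨q, s⟩ ⟨q', t⟩
  rw [← key i0 q q' s t, Matrix.kronecker_apply, Matrix.one_apply]
  simp

theorem kroneckerHom_coe (a : unitaryGroup (Fin k) ℂ) (b : unitaryGroup (Fin l) ℂ) :
    ((kroneckerHom k l (a, b) : unitaryGroup (Fin k × Fin l) ℂ) : MatProd k l) =
      (a : Mat k) ⊗ₖ (b : Mat l) := rfl

theorem one_kronecker_mem (hk : 0 < k) {b : Mat l}
    (hb : (1 : Mat k) ⊗ₖ b ∈ unitaryGroup (Fin k × Fin l) ℂ) : b ∈ unitaryGroup (Fin l) ℂ := by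
  let i0 : Fin k := ⟨0, hk⟩
  rw [Matrix.mem_unitaryGroup_iff] at hb ⊢
  rw [star_eq_conjTranspose, Matrix.conjTranspose_kronecker, ← Matrix.mul_kronecker_mul] at hb
  ext s t
  have h := congrFun (congrFun hb (i0, s)) (i0, t)
  simpa [Matrix.kronecker_apply, Matrix.one_apply, star_eq_conjTranspose] using h

/-- If conjugation by `v` maps `M_k(ℂ) ⊗ ℂE_l` into itself, then `v` is a
tensor product of unitary matrices. -/
theorem exists_eq_kroneckerHom (hk : 0 < k) (v : unitaryGroup (Fin k × Fin l) ℂ)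
    (hv : ∀ a : Mat k, ∃ a' : Mat k, (conjHom v).toAlgHom a = a' ⊗ₖ (1 : Mat l)) :
    ∃ a b, v = kroneckerHom k l (a, b) := by
  choose θ hθ using hv
  have hvv : star (v : MatProd k l) * (v : MatProd k l) = 1 := Unitary.coe_star_mul_self v
  -- A unitary matrix has a nonzero entry unless its size kl is 0; the empty case l = 0 is disposed
  -- of separately.
  have hl : (∃ t w : Fin l, ∃ p q : Fin k, (v : MatProd k l) (p, t) (q, w) ≠ 0) ∨ k * l = 0 := by
    by_contra! hcon
    obtain ⟨h1, h2⟩ := hcon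
    have hv0 : (v : MatProd k l) = 0 := by
      ext ⟨p, t⟩ ⟨q, w⟩
      exact h1 t w p q
    rw [hv0, mul_zero] at hvv
    have h3 := congrArg Matrix.trace hvv
    rw [Matrix.trace_one, Matrix.trace_zero, Fintype.card_prod, Fintype.card_fin,
      Fintype.card_fin] at h3
    exact h2 (by exact_mod_cast h3.symm)
  rcases hl with ⟨t, w, p, q, hpq⟩ | hl
  swap
  · have hl0 : l = 0 := (Nat.mul_eq_zero.1 hl).resolve_left hk.ne'
    subst hl0
    refine ⟨1, 1, Subtype.ext ?_⟩
    ext ⟨p, t⟩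
    exact t.elim0
  have hint : ∀ a, (v : MatProd k l) * (a ⊗ₖ (1 : Mat l)) = (θ a ⊗ₖ (1 : Mat l)) * v := by
    intro a
    rw [← hθ, conjHom_apply, mul_assoc, hvv, mul_one]
  -- A nonzero M_k-slice of `v` still intertwines `a` and `θ a`. Then A*A commutes with all of M_k,
  -- so it is a positive scalar, and A rescales to a unitary implementing `θ`.
  let A : Mat k := Matrix.of fun p q => (v : MatProd k l) (p, t) (q, w)
  have hA0 : A ≠ 0 := fun h => hpq (congrFun (congrFun h p) q)
  have hA : ∀ a, A * a = θ a * A := by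
    intro a
    ext i j
    have h := congrFun (congrFun (hint a) (i, t)) (j, w)
    rw [Matrix.mul_apply, Matrix.mul_apply, Fintype.sum_prod_type, Fintype.sum_prod_type] at h
    simp only [Matrix.kronecker_apply, Matrix.one_apply] at h
    rw [Matrix.mul_apply, Matrix.mul_apply]
    simpa [A] using h
  have hθs : ∀ a, θ (star a) = star (θ a) := by
    intro a
    have h : (θ (star a)) ⊗ₖ (1 : Mat l) = (star (θ a)) ⊗ₖ (1 : Mat l) := by
      rw [← star_kronecker_one, ← hθ, ← hθ, isStar_conjHom v a]
    ext i j
    simpa [Matrix.kronecker_apply] using congrFun (congrFun h (i, t)) (j, t)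
  have hcomm : ∀ a, Commute a (star A * A) := by
    intro a
    have h1 : star A * θ a = a * star A := by
      have := congrArg star (hA (star a))
      rw [star_mul, star_mul, hθs, star_star, star_star] at this
      exact this.symm
    calc a * (star A * A) = star A * θ a * A := by rw [h1, mul_assoc]
      _ = star A * A * a := by rw [mul_assoc, ← hA, mul_assoc]
  obtain ⟨c, hc⟩ : ∃ c : ℂ, c • (1 : Mat k) = star A * A := by
    have := Matrix.mem_range_scalar_of_commute_single (M := star A * A)
      (fun i j _ => hcomm (single i j 1))
    obtain ⟨c, hc⟩ := this
    exact ⟨c, by rw [← hc, Matrix.scalar_apply, Matrix.smul_one_eq_diagonal]⟩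
  have hcnn : 0 ≤ c := by
    have h1 : (0 : Mat k) ≤ c • 1 := hc ▸ star_mul_self_nonneg A
    have h2 := (Matrix.nonneg_iff_posSemidef.1 h1).diag_nonneg (i := p)
    simpa using h2
  have hc0 : c ≠ 0 := by
    rintro rfl
    rw [zero_smul] at hc
    apply hA0
    exact Matrix.conjTranspose_mul_self_eq_zero.1 hc.symm
  obtain ⟨r, hr0, rfl⟩ : ∃ r : ℝ, 0 ≤ r ∧ c = r :=
    ⟨c.re, (Complex.le_def.1 hcnn).1, Complex.ext rfl (Complex.le_def.1 hcnn).2.symm⟩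
  have hr : r ≠ 0 := by exact_mod_cast hc0
  have hs0 : ((Real.sqrt r : ℝ) : ℂ) ≠ 0 := by
    exact_mod_cast (Real.sqrt_pos.2 (lt_of_le_of_ne hr0 (Ne.symm hr))).ne'
  let a0 : Mat k := ((Real.sqrt r : ℝ) : ℂ)⁻¹ • A
  have ha0 : star a0 * a0 = 1 := by
    simp only [a0, star_smul, smul_mul_smul_comm, ← hc, smul_smul]
    rw [star_inv₀, Complex.star_def, Complex.conj_ofReal, ← mul_inv, ← Complex.ofReal_mul,
      Real.mul_self_sqrt hr0, inv_mul_cancel₀ hc0, one_smul]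
  have ha0u : a0 ∈ unitaryGroup (Fin k) ℂ := Matrix.mem_unitaryGroup_iff'.2 ha0
  have ha0' : a0 * star a0 = 1 := Matrix.mem_unitaryGroup_iff.1 ha0u
  have hθa : ∀ a, star a0 * θ a = a * star a0 := by
    intro a
    have h1 : a0 * a = θ a * a0 := by
      simp only [a0, Matrix.smul_mul, Matrix.mul_smul, hA]
    calc star a0 * θ a = star a0 * θ a * (a0 * star a0) := by rw [ha0', mul_one]
      _ = star a0 * (θ a * a0) * star a0 := by simp only [mul_assoc]
      _ = (star a0 * a0) * a * star a0 := by rw [← h1]; simp only [mul_assoc]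
      _ = _ := by rw [ha0, one_mul]
  let a1 : unitaryGroup (Fin k) ℂ := ⟨a0, ha0u⟩
  -- After removing `a0`, what is left of `v` lies in the commutant of M_k ⊗ ℂE_l, so it has the
  -- form 1 ⊗ b.
  have hw : ∀ a : Mat k, (((star a0) ⊗ₖ (1 : Mat l)) * (v : MatProd k l)) * (a ⊗ₖ (1 : Mat l)) =
      (a ⊗ₖ (1 : Mat l)) * (((star a0) ⊗ₖ (1 : Mat l)) * (v : MatProd k l)) := by
    intro a
    rw [mul_assoc, hint, ← mul_assoc, ← mul_assoc, ← Matrix.mul_kronecker_mul,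
      ← Matrix.mul_kronecker_mul, hθa]
  obtain ⟨b, hb⟩ := exists_eq_one_kronecker hk hw
  have hv2 : (v : MatProd k l) = a0 ⊗ₖ b := by
    calc (v : MatProd k l) = ((a0 * star a0) ⊗ₖ ((1 : Mat l) * 1)) * (v : MatProd k l) := by
          rw [ha0', mul_one, Matrix.one_kronecker_one, one_mul]
      _ = (a0 ⊗ₖ 1) * ((1 : Mat k) ⊗ₖ b) := by rw [Matrix.mul_kronecker_mul, mul_assoc, hb]
      _ = _ := by rw [← Matrix.mul_kronecker_mul, mul_one, one_mul]
  have hbu : b ∈ unitaryGroup (Fin l) ℂ := by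
    apply one_kronecker_mem hk
    rw [← hb]
    refine mul_mem ?_ v.2
    exact Matrix.kronecker_mem_unitary (Unitary.star_mem ha0u) (one_mem _)
  exact ⟨a1, ⟨b, hbu⟩, Subtype.ext hv2⟩

/-! ### Topology of the unitary groups, of `Hom(M_k(ℂ), M_{kl}(ℂ))` and of the Grassmannian -/

instance compactSpace_unitaryGroup (n : Type*) [Fintype n] [DecidableEq n] :
    CompactSpace (unitaryGroup n ℂ) := by
  refine (isCompact_iff_compactSpace (s := (unitaryGroup n ℂ : Set (Matrix n n ℂ)))).1 ?_
  have hK : IsCompact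
      {A : Matrix n n ℂ | ∀ i, A i ∈ {r : n → ℂ | ∀ j, r j ∈ Metric.closedBall 0 1}} :=
    isCompact_pi_infinite fun _ => isCompact_pi_infinite fun _ => isCompact_closedBall 0 1
  refine hK.of_isClosed_subset ?_ ?_
  · have h : ((unitaryGroup n ℂ : Set (Matrix n n ℂ))) = {A | A * star A = 1} := by
      ext A
      exact Matrix.mem_unitaryGroup_iff
    rw [h]
    exact isClosed_eq (by fun_prop) continuous_const
  · intro A hA i j
    simpa using entry_norm_bound_of_unitary hA i j

theorem continuous_unitary_coe {n : Type*} [Fintype n] [DecidableEq n] :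
    Continuous fun u : unitaryGroup n ℂ => (u : Matrix n n ℂ) := continuous_subtype_val

theorem continuous_kronecker {X m n : Type*} [TopologicalSpace X]
    {f : X → Matrix m m ℂ} {g : X → Matrix n n ℂ} (hf : Continuous f) (hg : Continuous g) :
    Continuous fun x => f x ⊗ₖ g x :=
  continuous_matrix fun i j => (hf.matrix_elem i.1 j.1).mul (hg.matrix_elem i.2 j.2)

theorem continuous_kroneckerHom : Continuous (kroneckerHom k l) := by
  refine Continuous.subtype_mk ?_ _
  exact continuous_kronecker (continuous_subtype_val.comp continuous_fst)
    (continuous_subtype_val.comp continuous_snd)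

theorem HomSpace.continuous_iff {X : Type*} [TopologicalSpace X] {f : X → HomSpace k l} :
    Continuous f ↔ ∀ a, Continuous fun x => (f x).toAlgHom a := by
  rw [continuous_induced_rng, continuous_pi_iff]
  rfl

theorem HomSpace.continuous_apply (a : Mat k) :
    Continuous fun h : HomSpace k l => h.toAlgHom a :=
  HomSpace.continuous_iff.1 continuous_id a

theorem HomSpace.toAlgHom_eq_sum (h : HomSpace k l) (a : Mat k) :
    h.toAlgHom a = ∑ i, ∑ j, a i j • h.toAlgHom (single i j 1) := by
  conv_lhs => rw [Matrix.matrix_eq_sum_single a]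
  simp only [map_sum, ← map_smul, Matrix.smul_single, smul_eq_mul, mul_one]

theorem HomSpace.continuous_eval :
    Continuous fun p : HomSpace k l × Mat k => p.1.toAlgHom p.2 := by
  have h : (fun p : HomSpace k l × Mat k => p.1.toAlgHom p.2) = fun p =>
      ∑ i, ∑ j, p.2 i j • p.1.toAlgHom (single i j 1) :=
    funext fun p => HomSpace.toAlgHom_eq_sum p.1 p.2
  rw [h]
  refine continuous_finsetSum _ fun i _ => continuous_finsetSum _ fun j _ => ?_
  exact (continuous_snd.matrix_elem i j).smul ((HomSpace.continuous_apply _).comp continuous_fst)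

instance : T2Space (HomSpace k l) := by
  refine T2Space.of_injective_continuous (f := fun h a => h.toAlgHom a) ?_ continuous_induced_dom
  intro h h' H
  exact HomSpace.ext fun a => congrFun H a

theorem smul_hom_apply (g : PU (Fin k)) (h : HomSpace k l) (a : Mat k) :
    (g • h).toAlgHom a = h.toAlgHom (g⁻¹ • a) := rfl

theorem mk_smul_hom_apply (w : unitaryGroup (Fin k) ℂ) (h : HomSpace k l) (a : Mat k) :
    ((QuotientGroup.mk w : PU (Fin k)) • h).toAlgHom a =
      h.toAlgHom (star (w : Mat k) * a * star (star (w : Mat k))) := rfl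

instance : ContinuousSMul (PU (Fin k)) (Mat k) where
  continuous_smul := by
    have hq : IsOpenQuotientMap
        (Prod.map (QuotientGroup.mk : unitaryGroup (Fin k) ℂ → PU (Fin k)) (id : Mat k → Mat k)) :=
      QuotientGroup.isOpenQuotientMap_mk.prodMap IsOpenQuotientMap.id
    rw [hq.isQuotientMap.continuous_iff]
    change Continuous fun p : unitaryGroup (Fin k) ℂ × Mat k =>
      (p.1 : Mat k) * p.2 * star (p.1 : Mat k)
    have h1 : Continuous fun p : unitaryGroup (Fin k) ℂ × Mat k => (p.1 : Mat k) :=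
      continuous_unitary_coe.comp continuous_fst
    exact (h1.mul continuous_snd).mul h1.star

instance : ContinuousSMul (PU (Fin k)) (HomSpace k l) where
  continuous_smul := by
    rw [HomSpace.continuous_iff]
    intro a
    simp only [smul_hom_apply]
    exact HomSpace.continuous_eval.comp (continuous_snd.prodMk
      ((continuous_fst.inv).smul continuous_const))

theorem conjHom_mul_kroneckerHom (u : unitaryGroup (Fin k × Fin l) ℂ)
    (a : unitaryGroup (Fin k) ℂ) (b : unitaryGroup (Fin l) ℂ) :
    conjHom (u * kroneckerHom k l (a, b)) =
      (QuotientGroup.mk a⁻¹ : PU (Fin k)) • conjHom u := by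
  refine HomSpace.ext fun x => ?_
  have hb : (b : Mat l) * star (b : Mat l) = 1 := Unitary.coe_mul_star_self b
  rw [mk_smul_hom_apply, conjHom_apply, conjHom_apply]
  have h1 : ((u * kroneckerHom k l (a, b) : unitaryGroup (Fin k × Fin l) ℂ) : MatProd k l) =
    (u : MatProd k l) * ((a : Mat k) ⊗ₖ (b : Mat l)) := rfl
  have h2 : ((a⁻¹ : unitaryGroup (Fin k) ℂ) : Mat k) = star (a : Mat k) := rfl
  rw [h1, h2, star_star, star_mul]
  have h3 : star ((a : Mat k) ⊗ₖ (b : Mat l)) = (star (a : Mat k)) ⊗ₖ (star (b : Mat l)) := by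
    simp [star_eq_conjTranspose, Matrix.conjTranspose_kronecker]
  calc _ = (u : MatProd k l) * (((a : Mat k) ⊗ₖ (b : Mat l)) * (x ⊗ₖ (1 : Mat l)) *
        star ((a : Mat k) ⊗ₖ (b : Mat l))) * star (u : MatProd k l) := by simp only [mul_assoc]
    _ = _ := by rw [h3, ← Matrix.mul_kronecker_mul, ← Matrix.mul_kronecker_mul, mul_one, hb]

theorem exists_of_conjHom_eq (hk : 0 < k) {u v : unitaryGroup (Fin k × Fin l) ℂ}
    (h : conjHom u = conjHom v) : ∃ b, v = u * kroneckerHom k l (1, b) := by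
  set w : unitaryGroup (Fin k × Fin l) ℂ := u⁻¹ * v with hw
  have hwc : (w : MatProd k l) = star (u : MatProd k l) * (v : MatProd k l) := rfl
  have hu : star (u : MatProd k l) * (u : MatProd k l) = 1 := Unitary.coe_star_mul_self u
  have hv : star (v : MatProd k l) * (v : MatProd k l) = 1 := Unitary.coe_star_mul_self v
  obtain ⟨b, hb⟩ := exists_eq_one_kronecker (v := (w : MatProd k l)) hk (by
    intro a
    have h1 := congrArg (fun H => HomSpace.toAlgHom H a) h
    simp only [conjHom_apply] at h1
    rw [hwc]
    calc _ = star (u : MatProd k l) * ((v : MatProd k l) * (a ⊗ₖ (1 : Mat l)) *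
          star (v : MatProd k l)) * (v : MatProd k l) := by
          simp only [mul_assoc, hv, mul_one]
      _ = (star (u : MatProd k l) * (u : MatProd k l)) * (a ⊗ₖ (1 : Mat l)) *
          (star (u : MatProd k l) * (v : MatProd k l)) := by rw [← h1]; simp only [mul_assoc]
      _ = _ := by rw [hu, one_mul])
  have hbu : b ∈ unitaryGroup (Fin l) ℂ := one_kronecker_mem hk (hb ▸ w.2)
  refine ⟨⟨b, hbu⟩, ?_⟩
  have : w = kroneckerHom k l (1, ⟨b, hbu⟩) := Subtype.ext hb
  rw [← this, hw, mul_inv_cancel_left]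

/-- The scalar phase divided out in PU(kl) is absorbed into the factor `b`. -/
theorem Gr.mk_eq_mk_iff {u v : unitaryGroup (Fin k × Fin l) ℂ} :
    Gr.mk u = Gr.mk v ↔ ∃ a b, v = u * kroneckerHom k l (a, b) := by
  constructor
  · intro h
    obtain ⟨⟨a, b⟩, hab⟩ := QuotientGroup.eq.1 h
    have h1 : (QuotientGroup.mk (kroneckerHom k l (a, b)) : PU (Fin k × Fin l)) =
      QuotientGroup.mk (u⁻¹ * v) := hab
    obtain ⟨φ, hφ⟩ := QuotientGroup.eq.1 h1
    have hexp : ∀ φ : ℝ, Complex.exp (φ * Complex.I) • (b : Mat l) ∈ unitaryGroup (Fin l) ℂ := by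
      intro φ
      have hb : star (b : Mat l) * (b : Mat l) = 1 := Unitary.coe_star_mul_self b
      rw [Matrix.mem_unitaryGroup_iff', star_smul, smul_mul_smul_comm, hb, Complex.star_def,
        ← Complex.exp_conj, ← Complex.exp_add]
      simp
    refine ⟨a, ⟨_, hexp φ⟩, ?_⟩
    have h2 : v = u * (kroneckerHom k l (a, b) * ((kroneckerHom k l (a, b))⁻¹ * (u⁻¹ * v))) := by
      group
    rw [h2]
    congr 1
    apply Subtype.ext
    have h3 : ((kroneckerHom k l (a, b) * ((kroneckerHom k l (a, b))⁻¹ * (u⁻¹ * v)) :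
        unitaryGroup (Fin k × Fin l) ℂ) : MatProd k l) = ((a : Mat k) ⊗ₖ (b : Mat l)) *
        (((kroneckerHom k l (a, b))⁻¹ * (u⁻¹ * v) : unitaryGroup (Fin k × Fin l) ℂ) :
          MatProd k l) := rfl
    rw [h3, hφ, kroneckerHom_coe, Matrix.kronecker_smul, Matrix.mul_smul, mul_one]
  · rintro ⟨a, b, rfl⟩
    refine QuotientGroup.eq.2 ⟨(a, b), ?_⟩
    change (QuotientGroup.mk (kroneckerHom k l (a, b)) : PU (Fin k × Fin l)) =
      QuotientGroup.mk (u⁻¹ * (u * kroneckerHom k l (a, b)))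
    rw [inv_mul_cancel_left]

/-- This identifies Gr with the orbit space of star-preserving homomorphisms: the factor `b` acts
trivially on `a ⊗ E`, and `a` acts through PU(k). -/
theorem Gr.mk_eq_mk_iff_conjHom (hk : 0 < k) {u v : unitaryGroup (Fin k × Fin l) ℂ} :
    Gr.mk u = Gr.mk v ↔ ∃ g : PU (Fin k), conjHom v = g • conjHom u := by
  rw [Gr.mk_eq_mk_iff]
  constructor
  · rintro ⟨a, b, rfl⟩
    exact ⟨_, conjHom_mul_kroneckerHom u a b⟩
  · rintro ⟨g, hg⟩
    induction g using QuotientGroup.induction_on with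
    | H w =>
    have h1 : conjHom (u * kroneckerHom k l (w⁻¹, 1)) = conjHom v := by
      rw [conjHom_mul_kroneckerHom, hg, inv_inv]
    obtain ⟨b, hb⟩ := exists_of_conjHom_eq hk h1
    exact ⟨w⁻¹, b, by rw [hb, mul_assoc, ← map_mul, Prod.mk_mul_mk, mul_one, one_mul]⟩

theorem Gr.mk_surjective : Function.Surjective (Gr.mk : _ → Gr k l) :=
  (QuotientGroup.mk_surjective (s := tensorSubgroup k l)).comp
    (QuotientGroup.mk_surjective (s := scalarUnitary (Fin k × Fin l)))

theorem Gr.isOpenQuotientMap_mk : IsOpenQuotientMap (Gr.mk : _ → Gr k l) :=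
  (QuotientGroup.isOpenQuotientMap_mk (N := tensorSubgroup k l)).comp
    (QuotientGroup.isOpenQuotientMap_mk (N := scalarUnitary (Fin k × Fin l)))

instance : CompactSpace (Gr k l) := by
  rw [← isCompact_univ_iff, ← Gr.mk_surjective.range_eq]
  exact isCompact_range Gr.isOpenQuotientMap_mk.continuous

instance : T2Space (Gr k l) := by
  rw [t2Space_iff_of_isOpenQuotientMap Gr.isOpenQuotientMap_mk]
  -- For an open quotient map, Hausdorffness amounts to a closed equivalence relation; here the
  -- relation is u⁻¹v ∈ U(k) ⊗ U(l), a compact set.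
  have h1 : IsClosed (range (kroneckerHom k l)) :=
    (isCompact_range continuous_kroneckerHom).isClosed
  have h2 : {q : unitaryGroup (Fin k × Fin l) ℂ × unitaryGroup (Fin k × Fin l) ℂ |
      Gr.mk q.1 = Gr.mk q.2} = (fun q => q.1⁻¹ * q.2) ⁻¹' range (kroneckerHom k l) := by
    ext ⟨u, v⟩
    rw [mem_ofPred_eq, Gr.mk_eq_mk_iff, mem_preimage]
    constructor
    · rintro ⟨a, b, hab⟩
      exact ⟨(a, b), eq_inv_mul_of_mul_eq hab.symm⟩
    · rintro ⟨⟨a, b⟩, hab⟩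
      exact ⟨a, b, by simp [hab]⟩
  rw [h2]
  exact h1.preimage (by fun_prop)

/-! ### The retraction onto star-preserving homomorphisms and the map to the Grassmannian -/

/-- The equivariant deformation of `Hom(M_k(ℂ), M_{kl}(ℂ))` to the subspace of star-preserving
homomorphisms. -/
def HomSpace.deform (s : unitInterval) (h : HomSpace k l) : HomSpace k l :=
  FAB.deform h.toAlgHom s

theorem HomSpace.deform_zero (h : HomSpace k l) : h.deform 0 = h := FAB.deform_zero h.toAlgHom

theorem HomSpace.isStar_deform_one (h : HomSpace k l) : (h.deform 1).IsStar :=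
  FAB.deform_one_star h.toAlgHom

theorem HomSpace.IsStar.deform_eq {h : HomSpace k l} (hs : h.IsStar) (s : unitInterval) :
    h.deform s = h :=
  FAB.deform_of_star h.toAlgHom hs s

theorem HomSpace.deform_smul (s : unitInterval) (g : PU (Fin k)) (h : HomSpace k l) :
    (g • h).deform s = g • h.deform s := by
  induction g using QuotientGroup.induction_on with
  | H w =>
  exact HomSpace.ext fun a => FAB.deform_comp h.toAlgHom (Unitary.star_mem w.2) _
    (fun a => mk_smul_hom_apply w h a) s a

theorem HomSpace.continuous_deform :
    Continuous fun p : unitInterval × HomSpace k l => p.2.deform p.1 := by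
  rw [HomSpace.continuous_iff]
  intro a
  change Continuous fun p : unitInterval × HomSpace k l =>
    interp p.2.toAlgHom p.1 * p.2.toAlgHom a * (interp p.2.toAlgHom p.1)⁻¹
  have h1 : Continuous fun p : unitInterval × HomSpace k l => gram p.2.toAlgHom := by
    refine continuous_finsetSum _ fun i _ => continuous_finsetSum _ fun j _ => ?_
    have := (HomSpace.continuous_apply (k := k) (l := l) (single i j 1)).comp
      (continuous_snd (X := unitInterval))
    exact this.star.mul this
  have h2 : Continuous fun p : unitInterval × HomSpace k l => interp p.2.toAlgHom p.1 := by
    have h3 : Continuous fun p : unitInterval × HomSpace k l => CFC.sqrt (gram p.2.toAlgHom) :=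
      continuousOn_matrix_sqrt.comp_continuous h1 fun p => gram_nonneg _
    have h4 : Continuous fun p : unitInterval × HomSpace k l => ((p.1 : ℝ) : ℂ) := by fun_prop
    have h5 : Continuous fun p : unitInterval × HomSpace k l => ((1 - (p.1 : ℝ) : ℝ) : ℂ) := by
      fun_prop
    exact (h5.smul continuous_const).add (h4.smul h3)
  refine (h2.mul ((HomSpace.continuous_apply a).comp continuous_snd)).mul ?_
  exact continuousOn_matrix_inv.comp_continuous h2 fun p => isUnit_interp _ _

theorem HomSpace.IsStar.smul {h : HomSpace k l} (hs : h.IsStar) (g : PU (Fin k)) :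
    (g • h).IsStar := by
  intro a
  rw [smul_hom_apply, smul_hom_apply, ← hs]
  congr 1
  exact map_star (conjPU (Fin k) g⁻¹) a

/-- The space of star-preserving homomorphisms. -/
abbrev StarHom (k l : ℕ) : Type := {h : HomSpace k l // h.IsStar}

/-- `u ↦ (a ↦ u (a ⊗ E) u*)` as a map to the space of star-preserving homomorphisms. -/
def conjStarHom (u : unitaryGroup (Fin k × Fin l) ℂ) : StarHom k l :=
  ⟨conjHom u, isStar_conjHom u⟩

theorem continuous_conjHom : Continuous (conjHom : _ → HomSpace k l) := by
  rw [HomSpace.continuous_iff]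
  intro a
  simp only [conjHom_apply]
  exact (continuous_unitary_coe.mul continuous_const).mul continuous_unitary_coe.star

theorem conjStarHom_surjective (hk : 0 < k) :
    Function.Surjective (conjStarHom : _ → StarHom k l) := by
  rintro ⟨h, hs⟩
  obtain ⟨u, hu⟩ := exists_conjHom_eq hk hs
  exact ⟨u, Subtype.ext hu⟩

/-- A continuous surjection from a compact space onto a Hausdorff space is closed. Hence the
topology of pointwise convergence is the quotient topology from U(kl). -/
theorem isQuotientMap_conjStarHom (hk : 0 < k) :
    IsQuotientMap (conjStarHom : _ → StarHom k l) := by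
  have hc : Continuous (conjStarHom : _ → StarHom k l) := continuous_conjHom.subtype_mk _
  exact hc.isClosedMap.isQuotientMap hc (conjStarHom_surjective hk)

/-- The point of the Grassmannian that corresponds to the image of a star-preserving
homomorphism. -/
def StarHom.toGr (hk : 0 < k) (h : StarHom k l) : Gr k l :=
  Gr.mk (conjStarHom_surjective hk h).choose

theorem StarHom.toGr_conjStarHom (hk : 0 < k) (u : unitaryGroup (Fin k × Fin l) ℂ) :
    StarHom.toGr hk (conjStarHom u) = Gr.mk u := by
  rw [StarHom.toGr, Gr.mk_eq_mk_iff_conjHom hk]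
  refine ⟨1, ?_⟩
  rw [one_smul]
  exact congrArg Subtype.val (conjStarHom_surjective hk (conjStarHom u)).choose_spec.symm

theorem StarHom.toGr_eq_iff (hk : 0 < k) {h h' : StarHom k l} :
    StarHom.toGr hk h = StarHom.toGr hk h' ↔ ∃ g : PU (Fin k), h'.1 = g • h.1 := by
  obtain ⟨u, rfl⟩ := conjStarHom_surjective hk h
  obtain ⟨v, rfl⟩ := conjStarHom_surjective hk h'
  rw [StarHom.toGr_conjStarHom, StarHom.toGr_conjStarHom, Gr.mk_eq_mk_iff_conjHom hk]
  rfl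

theorem StarHom.isOpenQuotientMap_toGr (hk : 0 < k) :
    IsOpenQuotientMap (StarHom.toGr hk : StarHom k l → Gr k l) := by
  have hq := isQuotientMap_conjStarHom (k := k) (l := l) hk
  have hcomp : StarHom.toGr hk ∘ conjStarHom = (Gr.mk : _ → Gr k l) :=
    funext fun u => StarHom.toGr_conjStarHom hk u
  refine ⟨?_, ?_, ?_⟩
  · have := Gr.mk_surjective (k := k) (l := l)
    rw [← hcomp] at this
    exact this.of_comp
  · rw [hq.continuous_iff, hcomp]
    exact Gr.isOpenQuotientMap_mk.continuous
  · intro O hO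
    have h1 : StarHom.toGr hk '' O = Gr.mk '' (conjStarHom ⁻¹' O) := by
      rw [← hcomp, image_comp, image_preimage_eq _ (conjStarHom_surjective hk)]
    rw [h1]
    exact Gr.isOpenQuotientMap_mk.isOpenMap _ (hO.preimage hq.continuous)

/-- The retraction of `Hom(M_k(ℂ), M_{kl}(ℂ))` to the subspace of star-preserving
homomorphisms. -/
def HomSpace.toStar (h : HomSpace k l) : StarHom k l := ⟨h.deform 1, h.isStar_deform_one⟩

theorem HomSpace.continuous_toStar : Continuous (HomSpace.toStar : HomSpace k l → StarHom k l) :=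
  (HomSpace.continuous_deform.comp (continuous_const.prodMk continuous_id)).subtype_mk _

theorem HomSpace.IsStar.toStar_eq {h : HomSpace k l} (hs : h.IsStar) : h.toStar = ⟨h, hs⟩ :=
  Subtype.ext (hs.deform_eq 1)

theorem HomSpace.toStar_smul (g : PU (Fin k)) (h : HomSpace k l) :
    (g • h).toStar.1 = g • h.toStar.1 := HomSpace.deform_smul 1 g h

/-! ### Spectral truncation of a positive matrix -/

section Truncation

variable {N M : Type*} [Fintype N] [DecidableEq N] [Fintype M]

/-- Twice the positive part of `ρ - c`. -/
def truncate (c : ℝ) (ρ : Matrix N N ℂ) : Matrix N N ℂ :=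
  CFC.abs (ρ - (c : ℂ) • 1) + (ρ - (c : ℂ) • 1)

theorem continuous_truncate (c : ℝ) : Continuous (truncate c : Matrix N N ℂ → Matrix N N ℂ) :=
  (continuous_matrix_abs.comp (continuous_id.sub continuous_const)).add
    (continuous_id.sub continuous_const)

theorem isSelfAdjoint_sub_smul {ρ : Matrix N N ℂ} (hρ : IsSelfAdjoint ρ) (c : ℝ) :
    IsSelfAdjoint (ρ - (c : ℂ) • (1 : Matrix N N ℂ)) := by
  refine hρ.sub ?_
  rw [IsSelfAdjoint, star_smul, star_one, Complex.star_def, Complex.conj_ofReal]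

theorem truncate_conj (c : ℝ) (ρ : Matrix N N ℂ) {V : Matrix N N ℂ} (hV : star V * V = 1)
    (hV' : V * star V = 1) : truncate c (V * ρ * star V) = V * truncate c ρ * star V := by
  have h1 : V * ρ * star V - (c : ℂ) • 1 = V * (ρ - (c : ℂ) • 1) * star V := by
    rw [mul_sub, sub_mul, Matrix.mul_smul, Matrix.smul_mul, mul_one, hV']
  rw [truncate, truncate, h1]
  set x := ρ - (c : ℂ) • (1 : Matrix N N ℂ)
  have h2 : CFC.abs (V * x * star V) = V * CFC.abs x * star V := by
    apply CFC.sqrt_unique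
    · calc V * CFC.abs x * star V * (V * CFC.abs x * star V)
          = V * CFC.abs x * (star V * V) * CFC.abs x * star V := by simp only [mul_assoc]
        _ = V * (CFC.abs x * CFC.abs x) * star V := by rw [hV, mul_one]; simp only [mul_assoc]
        _ = V * star x * (star V * V) * x * star V := by
            rw [CFC.abs_mul_abs, hV, mul_one]; simp only [mul_assoc]
        _ = star (V * x * star V) * (V * x * star V) := by
            rw [star_mul, star_mul, star_star]; simp only [mul_assoc]
    · exact star_right_conjugate_nonneg (CFC.abs_nonneg x) V
  rw [h2, mul_add, add_mul]

theorem truncate_nonneg {ρ : Matrix N N ℂ} (hρ : IsSelfAdjoint ρ) (c : ℝ) : 0 ≤ truncate c ρ := by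
  rw [truncate, CFC.abs_add_self _ (isSelfAdjoint_sub_smul hρ c)]
  exact nsmul_nonneg (CFC.posPart_nonneg _) 2

/-- With x = ρ - c and Q = |x| + x one has 2xQ = Q², so QxQ = Q³/2 ≥ 0: on the range of Q the form
of ρ is at least c. -/
theorem truncate_mul_mul {ρ : Matrix N N ℂ} (hρ : IsSelfAdjoint ρ) (c : ℝ) :
    0 ≤ star (truncate c ρ) * (ρ - (c : ℂ) • 1) * truncate c ρ := by
  have hx := isSelfAdjoint_sub_smul hρ c
  have hQ := truncate_nonneg hρ c
  have hQs : star (truncate c ρ) = truncate c ρ := (IsSelfAdjoint.of_nonneg hQ).star_eq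
  have hcomm : Commute (CFC.abs (ρ - (c : ℂ) • 1)) (ρ - (c : ℂ) • 1) :=
    CFC.commute_abs_self _ hx.isStarNormal
  have habs := CFC.abs_mul_abs (ρ - (c : ℂ) • 1)
  rw [hx.star_eq] at habs
  have h2 : (2 : ℂ) • ((ρ - (c : ℂ) • 1) * truncate c ρ) = truncate c ρ * truncate c ρ := by
    rw [truncate]
    set x := ρ - (c : ℂ) • (1 : Matrix N N ℂ)
    rw [mul_add, mul_add, add_mul, add_mul, habs, hcomm.eq, two_smul]
    abel
  have h3 : (ρ - (c : ℂ) • 1) * truncate c ρ = (1 / 2 : ℂ) • (truncate c ρ * truncate c ρ) := by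
    rw [← h2, smul_smul]; norm_num
  rw [mul_assoc, h3, Matrix.mul_smul, ← mul_assoc]
  refine smul_nonneg (by norm_num [Complex.le_def]) ?_
  have := star_left_conjugate_nonneg hQ (truncate c ρ)
  exact this

omit [DecidableEq N] in
theorem star_dotProduct_self (v : N → ℂ) : star v ⬝ᵥ v = ((∑ i, ‖v i‖ ^ 2 : ℝ) : ℂ) := by
  rw [dotProduct, Complex.ofReal_sum]
  refine Finset.sum_congr rfl fun i _ => ?_
  rw [Pi.star_apply, Complex.star_def, Complex.conj_mul', Complex.ofReal_pow]

theorem le_of_mem_range_truncate (R : Matrix N M ℂ) (c : ℝ) (w : N → ℂ) {b : N → ℂ}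
    (hb : b = truncate c (R * Rᴴ) *ᵥ w) :
    c * ∑ P, ‖b P‖ ^ 2 ≤ ∑ m, ‖(Rᴴ *ᵥ b) m‖ ^ 2 := by
  have hρ : IsSelfAdjoint (R * Rᴴ) := (Matrix.isHermitian_mul_conjTranspose_self R)
  have h0 := (Matrix.nonneg_iff_posSemidef.1 (truncate_mul_mul hρ c)).dotProduct_mulVec_nonneg w
  have h1 : star w ⬝ᵥ ((star (truncate c (R * Rᴴ)) * (R * Rᴴ - (c : ℂ) • 1) *
      truncate c (R * Rᴴ)) *ᵥ w) = star b ⬝ᵥ ((R * Rᴴ - (c : ℂ) • 1) *ᵥ b) := by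
    rw [hb, ← Matrix.mulVec_mulVec, ← Matrix.mulVec_mulVec, Matrix.dotProduct_mulVec,
      star_eq_conjTranspose, ← Matrix.star_mulVec]
  rw [h1, Matrix.sub_mulVec, dotProduct_sub, ← Matrix.mulVec_mulVec, Matrix.dotProduct_mulVec,
    Matrix.smul_mulVec, Matrix.one_mulVec, dotProduct_smul] at h0
  have h2 : star b ᵥ* R = star (Rᴴ *ᵥ b) := by
    rw [Matrix.star_mulVec, Matrix.conjTranspose_conjTranspose]
  rw [h2, star_dotProduct_self, star_dotProduct_self, smul_eq_mul, ← Complex.ofReal_mul,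
    ← Complex.ofReal_sub] at h0
  have h5 : (0 : ℝ) ≤ (∑ i, ‖(Rᴴ *ᵥ b) i‖ ^ 2) - c * ∑ i, ‖b i‖ ^ 2 := by exact_mod_cast h0
  linarith

/-- If `2c` exceeds the trace of `R R*`, then at most one eigenvalue of `R R*` survives
the truncation at `c`. -/
theorem exists_smul_of_truncate (R : Matrix N M ℂ) {c t : ℝ} (ht : ∑ P, ∑ m, ‖R P m‖ ^ 2 ≤ t)
    (hc : t < 2 * c) :
    ∃ v : N → ℂ, ∀ w, ∃ z : ℂ, truncate c (R * Rᴴ) *ᵥ w = z • v := by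
  set Q := truncate c (R * Rᴴ) with hQ
  let W : Submodule ℂ (EuclideanSpace ℂ N) := LinearMap.range (Matrix.toEuclideanLin Q)
  let B := stdOrthonormalBasis ℂ W
  have hc0 : 0 < c := by
    have : 0 ≤ t := le_trans (Finset.sum_nonneg fun _ _ => Finset.sum_nonneg fun _ _ => by
      positivity) ht
    linarith
  have hB : Orthonormal ℂ (fun i => (B i : EuclideanSpace ℂ N)) :=
    B.orthonormal.comp_linearIsometry W.subtypeₗᵢ
  -- Each unit vector in the range of the truncation contributes at least c to the squared
  -- Hilbert–Schmidt norm of R, and by Bessel's inequality the total is at most t < 2c. So the range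
  -- has dimension at most 1.
  have hlow : ∀ i, c ≤
      ∑ m, ‖inner ℂ (B i : EuclideanSpace ℂ N) (WithLp.toLp 2 fun P => R P m)‖ ^ 2 := by
    intro i
    obtain ⟨w, hw⟩ := (B i).2
    have hb : (fun P => (B i : EuclideanSpace ℂ N) P) = Q *ᵥ (fun P => w P) := by
      rw [← hw]; rfl
    have h1 := le_of_mem_range_truncate R c _ hb
    have h2 : ∑ P, ‖(B i : EuclideanSpace ℂ N) P‖ ^ 2 = 1 := by
      rw [← EuclideanSpace.norm_sq_eq, hB.1 i, one_pow]
    rw [h2, mul_one] at h1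
    refine h1.trans (le_of_eq (Finset.sum_congr rfl fun m _ => ?_))
    rw [← norm_star, PiLp.inner_apply]
    congr 2
    rw [Matrix.mulVec, dotProduct, star_sum]
    refine Finset.sum_congr rfl fun P _ => ?_
    simp [Matrix.conjTranspose_apply, mul_comm]
  have hup : ∀ m, ∑ i, ‖inner ℂ (B i : EuclideanSpace ℂ N) (WithLp.toLp 2 fun P => R P m)‖ ^ 2 ≤
      ∑ P, ‖R P m‖ ^ 2 := by
    intro m
    have := hB.sum_inner_products_le (WithLp.toLp 2 fun P => R P m) (s := Finset.univ)
    rwa [EuclideanSpace.norm_sq_eq] at this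
  have hfin : Module.finrank ℂ W ≤ 1 := by
    by_contra! hcon
    have h1 : (Module.finrank ℂ W : ℝ) * c ≤ t := by
      calc (Module.finrank ℂ W : ℝ) * c = ∑ _i : Fin (Module.finrank ℂ W), c := by simp
        _ ≤ ∑ i, ∑ m, ‖inner ℂ (B i : EuclideanSpace ℂ N) (WithLp.toLp 2 fun P => R P m)‖ ^ 2 :=
          Finset.sum_le_sum fun i _ => hlow i
        _ = ∑ m, ∑ i, ‖inner ℂ (B i : EuclideanSpace ℂ N) (WithLp.toLp 2 fun P => R P m)‖ ^ 2 :=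
          Finset.sum_comm
        _ ≤ ∑ m, ∑ P, ‖R P m‖ ^ 2 := Finset.sum_le_sum fun m _ => hup m
        _ = ∑ P, ∑ m, ‖R P m‖ ^ 2 := Finset.sum_comm
        _ ≤ t := ht
    have h2 : (2 : ℝ) ≤ Module.finrank ℂ W := by exact_mod_cast hcon
    nlinarith
  obtain ⟨v, hv⟩ := finrank_le_one_iff.1 hfin
  refine ⟨fun P => (v : EuclideanSpace ℂ N) P, fun w => ?_⟩
  obtain ⟨z, hz⟩ := hv ⟨Matrix.toEuclideanLin Q (WithLp.toLp 2 w), ⟨_, rfl⟩⟩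
  refine ⟨z, ?_⟩
  funext P
  have := congrArg (fun x : W => (x : EuclideanSpace ℂ N) P) hz
  exact this.symm

/-- If `ρ² = d ρ` with `d > 0`, then the truncation at `2d/3` is a multiple of `ρ`. -/
theorem truncate_of_mul_self {ρ : Matrix N N ℂ} (hρ : IsSelfAdjoint ρ) {d : ℝ} (hd : 0 < d)
    (h : ρ * ρ = (d : ℂ) • ρ) : truncate (2 * d / 3) ρ = (2 / 3 : ℂ) • ρ := by
  have hdc : (d : ℂ) ≠ 0 := by exact_mod_cast hd.ne'
  -- The eigenvalues of ρ can only be 0 and d, where |ρ - 2d/3| takes the values 2d/3 and d/3; the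
  -- affine function 2d/3 - ρ/3 interpolates them.
  have habs : CFC.abs (ρ - ((2 * d / 3 : ℝ) : ℂ) • 1) =
      ((2 * d / 3 : ℝ) : ℂ) • 1 - (1 / 3 : ℂ) • ρ := by
    apply CFC.sqrt_unique
    · rw [(isSelfAdjoint_sub_smul hρ _).star_eq]
      simp only [mul_sub, sub_mul, Matrix.smul_mul, Matrix.mul_smul, one_mul, mul_one, h, smul_smul]
      push_cast
      module
    · have h1 : ((2 * d / 3 : ℝ) : ℂ) • 1 - (1 / 3 : ℂ) • ρ = ((d / 3 : ℝ) : ℂ) • 1 +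
          ((1 / (3 * d) : ℝ) : ℂ) • (star ((d : ℂ) • 1 - ρ) * ((d : ℂ) • 1 - ρ)) := by
        have hs : star ((d : ℂ) • 1 - ρ) = (d : ℂ) • 1 - ρ := by
          rw [star_sub, star_smul, star_one, Complex.star_def, Complex.conj_ofReal, hρ.star_eq]
        rw [hs]
        simp only [mul_sub, sub_mul, Matrix.smul_mul, Matrix.mul_smul, one_mul, mul_one, h,
          smul_smul]
        push_cast
        match_scalars <;> field_simp <;> ring
      rw [h1]
      refine add_nonneg (smul_nonneg ?_ zero_le_one) (smul_nonneg ?_ (star_mul_self_nonneg _))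
      · exact_mod_cast (by positivity : 0 ≤ d / 3)
      · exact_mod_cast (by positivity : 0 ≤ 1 / (3 * d))
  rw [truncate, habs]
  module

end Truncation

/-! ### Local triviality of the bundle of star-preserving homomorphisms over the Grassmannian -/

/-- The Choi matrix of `a ↦ Tr_l (v* h(a) v)`. -/
def choi (v : unitaryGroup (Fin k × Fin l) ℂ) (h : HomSpace k l) :
    Matrix (Fin k × Fin k) (Fin k × Fin k) ℂ :=
  Matrix.of fun P Q => ∑ s : Fin l,
    (star (v : MatProd k l) * h.toAlgHom (single P.2 Q.2 1) * (v : MatProd k l)) (P.1, s) (Q.1, s)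

theorem continuous_choi (v : unitaryGroup (Fin k × Fin l) ℂ) :
    Continuous (choi v : HomSpace k l → _) := by
  refine continuous_matrix fun P Q => ?_
  simp only [choi, Matrix.of_apply]
  refine continuous_finsetSum _ fun s _ => ?_
  exact ((continuous_const.mul (HomSpace.continuous_apply _)).mul continuous_const).matrix_elem _ _

/-- A unitary matrix as an element of `M_k(ℂ) ⊗ M_l(ℂ)`, seen as a linear map. -/
def realign (v : unitaryGroup (Fin k × Fin l) ℂ) :
    Matrix (Fin k × Fin k) (Fin l × Fin l) ℂ :=
  Matrix.of fun P S => (v : MatProd k l) (P.1, S.1) (P.2, S.2)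

/-- The left side depends only on the homomorphism and is continuous in it; the right side, through
a chosen `u`, exhibits it as a positive matrix whose range lies in the span of the M_k-slices of
v*u. -/
theorem choi_conjHom (v u : unitaryGroup (Fin k × Fin l) ℂ) :
    choi v (conjHom u) = realign (v⁻¹ * u) * (realign (v⁻¹ * u))ᴴ := by
  ext ⟨p, i⟩ ⟨q, j⟩
  set w : unitaryGroup (Fin k × Fin l) ℂ := v⁻¹ * u with hw
  have hwc : (w : MatProd k l) = star (v : MatProd k l) * (u : MatProd k l) := rfl
  have h1 : star (v : MatProd k l) * (conjHom u).toAlgHom (single i j 1) * (v : MatProd k l) =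
      (w : MatProd k l) * (single i j 1 ⊗ₖ (1 : Mat l)) * star (w : MatProd k l) := by
    rw [conjHom_apply, hwc, star_mul, star_star]; simp only [mul_assoc]
  rw [choi, Matrix.of_apply, Matrix.mul_apply, Fintype.sum_prod_type]
  refine Finset.sum_congr rfl fun s _ => ?_
  rw [h1, Matrix.mul_apply, Fintype.sum_prod_type, Finset.sum_eq_single j]
  · refine Finset.sum_congr rfl fun m _ => ?_
    have h2 : ((w : MatProd k l) * ((single i j 1 : Mat k) ⊗ₖ (1 : Mat l))) (p, s) (j, m) =
        (w : MatProd k l) (p, s) (i, m) := by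
      rw [Matrix.mul_apply, Fintype.sum_prod_type, Finset.sum_eq_single i]
      · rw [Finset.sum_eq_single m] <;> simp +contextual
      · intro i' _ hi'
        refine Finset.sum_eq_zero fun m' _ => ?_
        simp [hi'.symm]
      · simp
    rw [h2]
    rfl
  · intro j' _ hj'
    refine Finset.sum_eq_zero fun m _ => ?_
    rw [Matrix.mul_apply, Finset.sum_eq_zero, zero_mul]
    rintro ⟨i', m'⟩ _
    simp [hj'.symm]
  · simp

/-- Realignment only permutes entries, and a unitary matrix of size kl has squared Hilbert–Schmidt
norm kl. This bounds the trace of the Choi matrix. -/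
theorem sum_realign (v : unitaryGroup (Fin k × Fin l) ℂ) :
    ∑ P, ∑ S, ‖realign v P S‖ ^ 2 = (k : ℝ) * l := by
  have h1 : ∀ x : Fin k × Fin l, ∑ y, ‖(v : MatProd k l) x y‖ ^ 2 = 1 := by
    intro x
    have hv : (v : MatProd k l) * star (v : MatProd k l) = 1 := Unitary.coe_mul_star_self v
    have h := congrFun (congrFun hv x) x
    rw [Matrix.mul_apply, Matrix.one_apply_eq] at h
    have h2 : ((∑ y, ‖(v : MatProd k l) x y‖ ^ 2 : ℝ) : ℂ) = 1 := by
      rw [← h, Complex.ofReal_sum]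
      refine Finset.sum_congr rfl fun y _ => ?_
      rw [Matrix.star_apply, Complex.star_def, Complex.mul_conj', Complex.ofReal_pow]
    exact_mod_cast h2
  calc ∑ P, ∑ S, ‖realign v P S‖ ^ 2
      = ∑ p, ∑ i, ∑ s, ∑ m, ‖(v : MatProd k l) (p, s) (i, m)‖ ^ 2 := by
        simp only [Fintype.sum_prod_type]; rfl
    _ = ∑ p, ∑ s, ∑ i, ∑ m, ‖(v : MatProd k l) (p, s) (i, m)‖ ^ 2 :=
        Finset.sum_congr rfl fun p _ => Finset.sum_comm
    _ = ∑ x : Fin k × Fin l, ∑ y, ‖(v : MatProd k l) x y‖ ^ 2 := by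
        simp only [Fintype.sum_prod_type]
    _ = _ := by simp [h1]

/-- The matrices on `M_k(ℂ)` given by right multiplication with `a*`. -/
def rightMul (a : Mat k) : Matrix (Fin k × Fin k) (Fin k × Fin k) ℂ :=
  (1 : Mat k) ⊗ₖ (star a)ᵀ

theorem rightMul_mem {a : Mat k} (ha : a ∈ unitaryGroup (Fin k) ℂ) :
    star (rightMul a) * rightMul a = 1 ∧ rightMul a * star (rightMul a) = 1 := by
  have h1 := Matrix.mem_unitaryGroup_iff.1 ha
  have h2 := Matrix.mem_unitaryGroup_iff'.1 ha
  have hs : star (rightMul a) = (1 : Mat k) ⊗ₖ aᵀ := by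
    rw [rightMul, star_eq_conjTranspose, Matrix.conjTranspose_kronecker, Matrix.conjTranspose_one]
    congr 1
    ext i j
    simp [Matrix.star_apply]
  rw [hs, rightMul, ← Matrix.mul_kronecker_mul, ← Matrix.mul_kronecker_mul, mul_one,
    ← Matrix.transpose_mul, ← Matrix.transpose_mul, h1, h2, Matrix.transpose_one,
    Matrix.one_kronecker_one]
  exact ⟨rfl, rfl⟩

theorem choi_smul (v : unitaryGroup (Fin k × Fin l) ℂ) (a : unitaryGroup (Fin k) ℂ)
    (h : HomSpace k l) :
    choi v ((QuotientGroup.mk a : PU (Fin k)) • h) =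
      rightMul (a : Mat k) * choi v h * star (rightMul (a : Mat k)) := by
  ext ⟨p, i⟩ ⟨q, j⟩
  have hs : star (rightMul (a : Mat k)) = (1 : Mat k) ⊗ₖ (a : Mat k)ᵀ := by
    rw [rightMul, star_eq_conjTranspose, Matrix.conjTranspose_kronecker, Matrix.conjTranspose_one]
    congr 1
    ext i j
    simp [Matrix.star_apply]
  have h1 : star (a : Mat k) * single i j 1 * star (star (a : Mat k)) =
      ∑ m, ∑ n, (star (a : Mat k) m i * (a : Mat k) j n) • single m n (1 : ℂ) := by
    rw [star_star, mul_single_eq_sum, Finset.sum_mul]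
    refine Finset.sum_congr rfl fun m _ => ?_
    rw [Matrix.smul_mul, single_mul_eq_sum, Finset.smul_sum]
    simp only [smul_smul]
  have h2 : choi v ((QuotientGroup.mk a : PU (Fin k)) • h) (p, i) (q, j) =
      ∑ m, ∑ n, star (a : Mat k) m i * (a : Mat k) j n * choi v h (p, m) (q, n) := by
    simp only [choi, Matrix.of_apply, mk_smul_hom_apply, h1, map_sum, map_smul, Finset.mul_sum,
      Finset.sum_mul, Matrix.mul_smul, Matrix.smul_mul, Matrix.sum_apply, Matrix.smul_apply,
      smul_eq_mul]
    rw [Finset.sum_comm]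
    refine Finset.sum_congr rfl fun m _ => ?_
    rw [Finset.sum_comm]
  have h3 : (rightMul (a : Mat k) * choi v h * star (rightMul (a : Mat k))) (p, i) (q, j) =
      ∑ n, ∑ m, star (a : Mat k) m i * choi v h (p, m) (q, n) * (a : Mat k) j n := by
    rw [hs, rightMul]
    simp only [Matrix.mul_apply, Fintype.sum_prod_type, Matrix.kronecker_apply,
      Matrix.transpose_apply, Matrix.one_apply]
    simp [Finset.sum_mul]
  rw [h2, h3, Finset.sum_comm]
  refine Finset.sum_congr rfl fun n _ => Finset.sum_congr rfl fun m _ => by ring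

/-- The action of a matrix of size `k²` on `M_k(ℂ)`. -/
def actMat (M : Matrix (Fin k × Fin k) (Fin k × Fin k) ℂ) (w : Mat k) : Mat k :=
  Matrix.of fun p i => (M *ᵥ fun P => w P.1 P.2) (p, i)

theorem actMat_rightMul (a w : Mat k) : actMat (rightMul a) w = w * star a := by
  ext p i
  rw [actMat, Matrix.of_apply, Matrix.mulVec, dotProduct, Matrix.mul_apply, Fintype.sum_prod_type,
    rightMul]
  simp [Matrix.one_apply, mul_comm]

theorem actMat_mul (M M' : Matrix (Fin k × Fin k) (Fin k × Fin k) ℂ) (w : Mat k) :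
    actMat (M * M') w = actMat M (actMat M' w) := by
  ext p i
  rw [actMat, Matrix.of_apply, ← Matrix.mulVec_mulVec]
  rfl

/-- The truncated Choi matrix. -/
def truncChoi (v : unitaryGroup (Fin k × Fin l) ℂ) (h : HomSpace k l) :
    Matrix (Fin k × Fin k) (Fin k × Fin k) ℂ :=
  truncate (2 * ((k : ℝ) * l) / 3) (choi v h)

theorem continuous_truncChoi (v : unitaryGroup (Fin k × Fin l) ℂ) :
    Continuous (truncChoi v : HomSpace k l → _) :=
  (continuous_truncate _).comp (continuous_choi v)

/-- Truncation commutes with unitary conjugation, so the surviving line in M_k is multiplied on the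
right by a* when h is moved by a. -/
theorem actMat_truncChoi_smul (v : unitaryGroup (Fin k × Fin l) ℂ) (a : unitaryGroup (Fin k) ℂ)
    (h : HomSpace k l) (w : Mat k) :
    actMat (truncChoi v ((QuotientGroup.mk a : PU (Fin k)) • h)) (w * star (a : Mat k)) =
      actMat (truncChoi v h) w * star (a : Mat k) := by
  obtain ⟨h1, h2⟩ := rightMul_mem a.2
  rw [truncChoi, choi_smul, truncate_conj _ _ h1 h2, ← actMat_rightMul _ w, ← actMat_mul, mul_assoc,
    h1, mul_one, actMat_mul, actMat_rightMul]
  rfl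

/-- The trace is kl and the threshold 2kl/3 exceeds half of it, so two eigenvalues cannot both
survive. -/
theorem exists_smul_truncChoi (hk : 0 < k) (hl : 0 < l) (v : unitaryGroup (Fin k × Fin l) ℂ)
    (h : StarHom k l) : ∃ b : Mat k, ∀ w, ∃ z : ℂ, actMat (truncChoi v h.1) w = z • b := by
  obtain ⟨u, rfl⟩ := conjStarHom_surjective hk h
  have hkl : 0 < (k : ℝ) * l := by positivity
  obtain ⟨b, hb⟩ := exists_smul_of_truncate (realign (v⁻¹ * u)) (c := 2 * ((k : ℝ) * l) / 3)
    (sum_realign _).le (by linarith)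
  refine ⟨Matrix.of fun p i => b (p, i), fun w => ?_⟩
  obtain ⟨z, hz⟩ := hb fun P => w P.1 P.2
  refine ⟨z, ?_⟩
  ext p i
  rw [actMat, Matrix.of_apply, truncChoi]
  change (truncate _ (choi v (conjHom u)) *ᵥ _) (p, i) = _
  rw [choi_conjHom, hz]
  rfl

/-- At the base point w = 1, and the Choi matrix is kl times the projection onto the line of the
identity matrix. Its eigenvalue kl lies above the threshold 2kl/3, so the truncation maps E_k to
(2/3)kl E_k. -/
theorem isUnit_truncChoi_self (hk : 0 < k) (hl : 0 < l) (v : unitaryGroup (Fin k × Fin l) ℂ) :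
    IsUnit (actMat (truncChoi v (conjHom v)) 1) := by
  have hkl : 0 < (k : ℝ) * l := by positivity
  have hρ : IsSelfAdjoint (choi v (conjHom v)) := by
    rw [choi_conjHom]
    exact Matrix.isHermitian_mul_conjTranspose_self _
  have hentry : ∀ p i q j, choi v (conjHom v) (p, i) (q, j) =
      if p = i ∧ q = j then (l : ℂ) else 0 := by
    intro p i q j
    rw [choi_conjHom, inv_mul_cancel, Matrix.mul_apply, Fintype.sum_prod_type]
    have : ∀ P S, realign (1 : unitaryGroup (Fin k × Fin l) ℂ) P S =
        if P.1 = P.2 ∧ S.1 = S.2 then 1 else 0 := by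
      intro P S
      rw [realign, Matrix.of_apply, OneMemClass.coe_one, Matrix.one_apply]
      simp
    simp only [Matrix.conjTranspose_apply, this]
    by_cases h1 : p = i <;> by_cases h2 : q = j <;> simp [h1, h2]
  have hmul : choi v (conjHom v) * choi v (conjHom v) =
      (((k : ℝ) * l : ℝ) : ℂ) • choi v (conjHom v) := by
    ext ⟨p, i⟩ ⟨q, j⟩
    rw [Matrix.mul_apply, Fintype.sum_prod_type, Matrix.smul_apply]
    simp only [hentry]
    by_cases h1 : p = i <;> by_cases h2 : q = j <;> simp [h1, h2]
    ring
  have hact : actMat (truncChoi v (conjHom v)) 1 = (2 / 3 * (k * l) : ℂ) • 1 := by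
    ext p i
    rw [actMat, Matrix.of_apply, truncChoi, truncate_of_mul_self hρ hkl hmul, Matrix.mulVec,
      dotProduct, Fintype.sum_prod_type]
    simp only [Matrix.smul_apply, hentry, Matrix.one_apply]
    by_cases h1 : p = i <;> simp [h1]
    ring
  rw [hact]
  have h0 : (2 / 3 * (k * l) : ℂ) ≠ 0 := by
    have h1 : (k : ℂ) ≠ 0 := Nat.cast_ne_zero.2 hk.ne'
    have h2 : (l : ℂ) ≠ 0 := Nat.cast_ne_zero.2 hl.ne'
    simp [h1, h2]
  exact (isUnit_smul_iff (Units.mk0 _ h0) (1 : Mat k)).2 isUnit_one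

/-- The class of the unitary factor of an invertible matrix. -/
def polarClass (b : Mat k) : PU (Fin k) :=
  open Classical in
  if hb : IsUnit b then QuotientGroup.mk ⟨polarFactor b, polarFactor_mem hb⟩ else 1

theorem polarClass_of_isUnit {b : Mat k} (hb : IsUnit b) :
    polarClass b = QuotientGroup.mk ⟨polarFactor b, polarFactor_mem hb⟩ := dif_pos hb

theorem continuousOn_polarClass : ContinuousOn (polarClass : Mat k → _) {b | IsUnit b} := by
  rw [continuousOn_iff_continuous_domRestrict]
  have h : Set.domRestrict {b : Mat k | IsUnit b} polarClass = fun b =>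
      (QuotientGroup.mk (⟨polarFactor b.1, polarFactor_mem b.2⟩ : unitaryGroup (Fin k) ℂ) :
        PU (Fin k)) := funext fun b => polarClass_of_isUnit b.2
  rw [h]
  exact QuotientGroup.continuous_mk.comp
    ((continuousOn_iff_continuous_domRestrict.1 continuousOn_polarFactor).subtype_mk _)

theorem polarClass_smul {b : Mat k} (hb : IsUnit b) {z : ℂ} (hz : z ≠ 0) :
    polarClass (z • b) = polarClass b := by
  have hzb : IsUnit (z • b) := (isUnit_smul_iff (Units.mk0 _ hz) b).2 hb
  obtain ⟨φ, hφ⟩ := polarFactor_smul hb hz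
  rw [polarClass_of_isUnit hb, polarClass_of_isUnit hzb, eq_comm, QuotientGroup.eq]
  refine ⟨φ, ?_⟩
  change star (polarFactor b) * polarFactor (z • b) = _
  rw [hφ, Matrix.mul_smul, Matrix.mem_unitaryGroup_iff'.1 (polarFactor_mem hb)]

theorem polarClass_mul_star {b : Mat k} (hb : IsUnit b) (a : unitaryGroup (Fin k) ℂ) :
    polarClass (b * star (a : Mat k)) = polarClass b * (QuotientGroup.mk a : PU (Fin k))⁻¹ := by
  have ha : star (a : Mat k) ∈ unitaryGroup (Fin k) ℂ := Unitary.star_mem a.2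
  have hau : IsUnit (star (a : Mat k)) :=
    IsUnit.of_mul_eq_one (star (star (a : Mat k))) (Matrix.mem_unitaryGroup_iff.1 ha)
  rw [polarClass_of_isUnit hb, polarClass_of_isUnit (hb.mul hau), ← QuotientGroup.mk_inv,
    ← QuotientGroup.mk_mul]
  congr 1
  exact Subtype.ext (polarFactor_mul_unitary hb ha)

/-- The set over which the trivialisation around `conjHom v` is defined. -/
def chartSet (v : unitaryGroup (Fin k × Fin l) ℂ) : Set (StarHom k l) :=
  {h | ∃ w, IsUnit (actMat (truncChoi v h.1) w)}

/-- The equivariant trivialisation around `conjHom v`. -/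
def chart (v : unitaryGroup (Fin k × Fin l) ℂ) (h : StarHom k l) : PU (Fin k) :=
  open Classical in
  if H : h ∈ chartSet v then (polarClass (actMat (truncChoi v h.1) H.choose))⁻¹ else 1

/-- The values of the truncated matrix lie on one line, so two invertible values are proportional
and have the same class in PU(k). Independence of `w` allows it to be held fixed locally for
continuity and translated for equivariance. -/
theorem chart_eq (hk : 0 < k) (hl : 0 < l) (v : unitaryGroup (Fin k × Fin l) ℂ) {h : StarHom k l}
    {w : Mat k} (hw : IsUnit (actMat (truncChoi v h.1) w)) :
    chart v h = (polarClass (actMat (truncChoi v h.1) w))⁻¹ := by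
  have H : h ∈ chartSet v := ⟨w, hw⟩
  rw [chart, dif_pos H]
  congr 1
  have hk0 : Nontrivial (Mat k) := by
    have : Nonempty (Fin k) := ⟨⟨0, hk⟩⟩
    infer_instance
  obtain ⟨b, hb⟩ := exists_smul_truncChoi hk hl v h
  have key : ∀ w, IsUnit (actMat (truncChoi v h.1) w) →
      polarClass (actMat (truncChoi v h.1) w) = polarClass b := by
    intro w hw
    obtain ⟨z, hz⟩ := hb w
    rw [hz] at hw ⊢
    have hz0 : z ≠ 0 := by
      rintro rfl
      rw [zero_smul] at hw
      exact not_isUnit_zero hw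
    exact polarClass_smul ((isUnit_smul_iff (Units.mk0 _ hz0) b).1 hw) hz0
  rw [key _ H.choose_spec, key _ hw]

theorem isOpen_isUnit_mat : IsOpen {b : Mat k | IsUnit b} := by
  have : {b : Mat k | IsUnit b} = {b | b.det ≠ 0} := by
    ext b
    exact (Matrix.isUnit_iff_isUnit_det b).trans isUnit_iff_ne_zero
  rw [this]
  exact isOpen_ne_fun continuous_id.matrix_det continuous_const

theorem continuous_actMat_truncChoi (v : unitaryGroup (Fin k × Fin l) ℂ) (w : Mat k) :
    Continuous fun h : StarHom k l => actMat (truncChoi v h.1) w := by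
  refine continuous_matrix fun p i => ?_
  exact (continuous_apply (p, i)).comp
    (((continuous_truncChoi v).comp continuous_subtype_val).matrix_mulVec continuous_const)

theorem isOpen_chartSet (v : unitaryGroup (Fin k × Fin l) ℂ) : IsOpen (chartSet v) := by
  have : chartSet v = ⋃ w, {h : StarHom k l | IsUnit (actMat (truncChoi v h.1) w)} := by
    ext h
    simp [chartSet]
  rw [this]
  exact isOpen_iUnion fun w => isOpen_isUnit_mat.preimage (continuous_actMat_truncChoi v w)

theorem continuousOn_chart (hk : 0 < k) (hl : 0 < l) (v : unitaryGroup (Fin k × Fin l) ℂ) :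
    ContinuousOn (chart v) (chartSet v) := by
  rintro h ⟨w, hw⟩
  apply ContinuousAt.continuousWithinAt
  have h1 : ContinuousAt (fun h : StarHom k l => (polarClass (actMat (truncChoi v h.1) w))⁻¹) h :=
    (ContinuousAt.comp (f := fun h : StarHom k l => actMat (truncChoi v h.1) w)
      (continuousOn_polarClass.continuousAt (isOpen_isUnit_mat.mem_nhds hw))
      (continuous_actMat_truncChoi v w).continuousAt).inv
  refine h1.congr ?_
  filter_upwards [(isOpen_isUnit_mat.preimage (continuous_actMat_truncChoi v w)).mem_nhds hw]
    with h' hh' using (chart_eq hk hl v hh').symm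

theorem isUnit_actMat_smul {v : unitaryGroup (Fin k × Fin l) ℂ} {h h' : StarHom k l}
    (a : unitaryGroup (Fin k) ℂ) (hh' : h'.1 = (QuotientGroup.mk a : PU (Fin k)) • h.1)
    {w : Mat k} (hw : IsUnit (actMat (truncChoi v h.1) w)) :
    IsUnit (actMat (truncChoi v h'.1) (w * star (a : Mat k))) := by
  rw [hh', actMat_truncChoi_smul]
  exact hw.mul (IsUnit.of_mul_eq_one (a : Mat k) (Matrix.mem_unitaryGroup_iff'.1 a.2))

/-- The spanning matrix is multiplied by a* on the right; the inverse in `chart` turns this into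
left multiplication by the class of a. -/
theorem chart_smul (hk : 0 < k) (hl : 0 < l) (v : unitaryGroup (Fin k × Fin l) ℂ)
    (g : PU (Fin k)) {h h' : StarHom k l} (hh' : h'.1 = g • h.1) (hh : h ∈ chartSet v) :
    chart v h' = g * chart v h := by
  obtain ⟨w, hw⟩ := hh
  induction g using QuotientGroup.induction_on with
  | H a =>
  rw [chart_eq hk hl v hw, chart_eq hk hl v (isUnit_actMat_smul a hh' hw), hh',
    actMat_truncChoi_smul, polarClass_mul_star hw, _root_.mul_inv_rev, inv_inv]

theorem mem_chartSet_of_smul {v : unitaryGroup (Fin k × Fin l) ℂ}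
    (g : PU (Fin k)) {h h' : StarHom k l} (hh' : h'.1 = g • h.1) (hh : h ∈ chartSet v) :
    h' ∈ chartSet v := by
  obtain ⟨w, hw⟩ := hh
  induction g using QuotientGroup.induction_on with
  | H a => exact ⟨_, isUnit_actMat_smul a hh' hw⟩

/-- The principal `PU(k)`-bundle of star-preserving homomorphisms over the Grassmannian has a
finite numerated family of trivialisations. -/
theorem exists_finiteTriv (hk : 0 < k) (hl : 0 < l) :
    ∃ ι : Finset (Gr k l), Nonempty (FiniteTriv (PU (Fin k)) (StarHom k l)
      (fun g h h' => h'.1 = g • h.1) ι) := by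
  classical
  choose v hv using Gr.mk_surjective (k := k) (l := l)
  let O : Gr k l → Set (Gr k l) := fun x => StarHom.toGr hk '' chartSet (v x)
  have hO : ∀ x, IsOpen (O x) := fun x =>
    (StarHom.isOpenQuotientMap_toGr hk).isOpenMap _ (isOpen_chartSet _)
  have hxO : ∀ x, x ∈ O x := fun x =>
    ⟨conjStarHom (v x), ⟨1, isUnit_truncChoi_self hk hl (v x)⟩, by
      rw [StarHom.toGr_conjStarHom, hv]⟩
  have hmem : ∀ x (h : StarHom k l), StarHom.toGr hk h ∈ O x → h ∈ chartSet (v x) := by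
    rintro x h ⟨h', hh', heq⟩
    obtain ⟨g, hg⟩ := (StarHom.toGr_eq_iff hk).1 heq
    exact mem_chartSet_of_smul g hg hh'
  have hbump : ∀ x, ∃ f : C(Gr k l, ℝ), EqOn f 0 (O x)ᶜ ∧ EqOn f 1 {x} ∧
      ∀ y, f y ∈ Icc (0 : ℝ) 1 := fun x =>
    exists_continuous_zero_one_of_isClosed (hO x).isClosed_compl isClosed_singleton
      (disjoint_singleton_right.2 fun h => h (hxO x))
  choose f hf0 hf1 _ using hbump
  -- Finitely many sets {f_x > 1/2} cover the compact Grassmannian; doubling the bump functions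
  -- makes some τ at least 1 at every point.
  obtain ⟨ι, hι⟩ := isCompact_univ.elim_nhds_subcover (fun x => {y | 1 / 2 < f x y}) (fun x _ =>
    (isOpen_lt continuous_const (f x).continuous).mem_nhds (by
      have := hf1 x (mem_singleton x)
      simp only [mem_ofPred_eq, this, Pi.one_apply]
      norm_num))
  have hcont := (StarHom.isOpenQuotientMap_toGr (k := k) (l := l) hk).continuous
  have hpos : ∀ x (h : StarHom k l), 0 < 2 * f x (StarHom.toGr hk h) → h ∈ chartSet (v x) := by
    intro x h hp
    apply hmem
    by_contra hcon
    have := hf0 x hcon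
    simp [this] at hp
  refine ⟨ι, ⟨{
    τ := fun x h => 2 * f x.1 (StarHom.toGr hk h)
    γ := fun x => chart (v x.1)
    continuous_τ := fun x => continuous_const.mul ((f x.1).continuous.comp hcont)
    continuousOn_γ := fun x => (continuousOn_chart hk hl _).mono fun h hh => hpos _ h hh
    τ_inv := fun x g h h' hh' => by
      rw [(StarHom.toGr_eq_iff hk).2 ⟨g, hh'⟩]
    γ_equiv := fun x g h h' hh' hp => chart_smul hk hl _ g hh' (hpos _ h hp)
    cover := fun h => ?_ }⟩⟩
  obtain ⟨x, hx, hxf⟩ := mem_iUnion₂.1 (hι.2 (mem_univ (StarHom.toGr hk h)))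
  refine ⟨⟨x, hx⟩, ?_⟩
  have : 1 / 2 < f x (StarHom.toGr hk h) := hxf
  change 1 ≤ 2 * f x (StarHom.toGr hk h)
  linarith

/-! ### Principal bundles -/

section Principal

variable {G E B : Type*} [Group G] [TopologicalSpace G]
  [TopologicalSpace E] [TopologicalSpace B] [MulAction G E] {π : C(E, B)}

theorem IsPrincipalBundle.surjective (hπ : IsPrincipalBundle G π) : Function.Surjective π := by
  intro b
  obtain ⟨Φ, hb, -⟩ := hπ.exists_trivialization b
  exact ⟨Φ.toOpenPartialHomeomorph.symm (b, 1), Φ.proj_symm_apply' hb⟩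

theorem IsPrincipalBundle.eq_smul (hπ : IsPrincipalBundle G π)
    {Φ : Bundle.Trivialization G (π : E → B)}
    (hΦ : ∀ (g : G) (e : E), π e ∈ Φ.baseSet → (Φ (g • e)).2 = g * (Φ e).2) {e e' : E}
    (he : π e ∈ Φ.baseSet) (h : π e = π e') : e' = ((Φ e').2 * (Φ e).2⁻¹) • e := by
  have he' : π e' ∈ Φ.baseSet := h ▸ he
  have hs : π (((Φ e').2 * (Φ e).2⁻¹) • e) ∈ Φ.baseSet := by rwa [hπ.proj_smul]
  have heq : Φ e' = Φ (((Φ e').2 * (Φ e).2⁻¹) • e) := by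
    refine Prod.ext ?_ ?_
    · rw [Φ.coe_fst' he', Φ.coe_fst' hs, hπ.proj_smul, h]
    · rw [hΦ _ _ he, inv_mul_cancel_right]
  exact Φ.injOn (Φ.mem_source.2 he') (Φ.mem_source.2 hs) heq

theorem IsPrincipalBundle.exists_smul (hπ : IsPrincipalBundle G π) {e e' : E} (h : π e = π e') :
    ∃ g : G, e' = g • e := by
  obtain ⟨Φ, hb, hΦ⟩ := hπ.exists_trivialization (π e)
  exact ⟨_, hπ.eq_smul hΦ hb h⟩

theorem IsPrincipalBundle.smul_left_injective (hπ : IsPrincipalBundle G π) {e : E} {g g' : G}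
    (h : g • e = g' • e) : g = g' := by
  obtain ⟨Φ, hb, hΦ⟩ := hπ.exists_trivialization (π e)
  have h1 := congrArg (fun x => (Φ x).2) h
  simp only [hΦ _ _ hb] at h1
  exact mul_right_cancel h1

/-- The group element that carries `e` to `e'`, if both lie in the same fibre. -/
def IsPrincipalBundle.translation (hπ : IsPrincipalBundle G π) (e e' : E) (h : π e = π e') : G :=
  (hπ.exists_smul h).choose

theorem IsPrincipalBundle.translation_smul (hπ : IsPrincipalBundle G π) {e e' : E}
    (h : π e = π e') : hπ.translation e e' h • e = e' :=
  (hπ.exists_smul h).choose_spec.symm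

/-- In a trivialisation the translation is the quotient of the two fibre coordinates; freeness of
the action shows that it agrees with the chosen element. -/
theorem IsPrincipalBundle.continuous_translation [IsTopologicalGroup G]
    (hπ : IsPrincipalBundle G π) {X : Type*}
    [TopologicalSpace X] {a b : X → E} (ha : Continuous a) (hb : Continuous b)
    (h : ∀ x, π (a x) = π (b x)) : Continuous fun x => hπ.translation (a x) (b x) (h x) := by
  rw [continuous_iff_continuousAt]
  intro x
  obtain ⟨Φ, hx, hΦ⟩ := hπ.exists_trivialization (π (a x))
  have hΦa : ContinuousAt (fun y => (Φ (a y)).2) x :=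
    continuousAt_snd.comp ((Φ.continuousAt (Φ.mem_source.2 hx)).comp ha.continuousAt)
  have hΦb : ContinuousAt (fun y => (Φ (b y)).2) x :=
    continuousAt_snd.comp ((Φ.continuousAt (Φ.mem_source.2 (h x ▸ hx))).comp hb.continuousAt)
  refine (hΦb.mul hΦa.inv).congr ?_
  have ho : IsOpen {y | π (a y) ∈ Φ.baseSet} := Φ.open_baseSet.preimage (π.continuous.comp ha)
  filter_upwards [ho.mem_nhds hx] with y hy
  apply hπ.smul_left_injective (e := a y)
  rw [hπ.translation_smul]
  exact (hπ.eq_smul hΦ hy (h y)).symm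

end Principal

/-! ### Associated bundles -/

section Assoc

variable {G E F : Type*} [Group G] [MulAction G E] [MulAction G F]

theorem Assoc.mk_smul_smul (g : G) (e : E) (f : F) :
    Assoc.mk G (g • e) (g • f) = Assoc.mk G e f :=
  Quotient.sound ⟨g, rfl⟩

theorem Assoc.mk_smul (g : G) (e : E) (f : F) : Assoc.mk G (g • e) f = Assoc.mk G e (g⁻¹ • f) := by
  rw [← Assoc.mk_smul_smul g e, smul_inv_smul]

theorem Assoc.mk_eq_mk_iff {e e' : E} {f f' : F} :
    Assoc.mk G e f = Assoc.mk G e' f' ↔ ∃ g : G, g • e' = e ∧ g • f' = f := by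
  constructor
  · intro h
    obtain ⟨g, hg⟩ := Quotient.exact h
    exact ⟨g, congrArg Prod.fst hg, congrArg Prod.snd hg⟩
  · rintro ⟨g, rfl, rfl⟩
    exact Assoc.mk_smul_smul g e' f'

theorem Assoc.isOpenQuotientMap_mk [TopologicalSpace E] [TopologicalSpace F]
    [ContinuousConstSMul G E] [ContinuousConstSMul G F] :
    IsOpenQuotientMap fun p : E × F => Assoc.mk G p.1 p.2 :=
  MulAction.isOpenQuotientMap_quotientMk

end Assoc

theorem exists_lift_of_isQuotientMap {X Y Z : Type*} [TopologicalSpace X]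
    [TopologicalSpace Y] [TopologicalSpace Z] {q : X → Y} (hq : IsQuotientMap q) {f : X → Z}
    (hf : Continuous f) (h : ∀ x x', q x = q x' → f x = f x') :
    ∃ F : C(Y, Z), ∀ x, F (q x) = f x := by
  have h1 : Function.FactorsThrough (⟨f, hf⟩ : C(X, Z)) q := h
  exact ⟨IsQuotientMap.lift (f := ⟨q, hq.continuous⟩) hq ⟨f, hf⟩ h1,
    DFunLike.congr_fun (IsQuotientMap.lift_comp (f := ⟨q, hq.continuous⟩) hq _ h1)⟩

/-- Two quotients of the same space with the same fibres are homeomorphic. -/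
theorem exists_homeomorph_of_isQuotientMap {X Y Z : Type*} [TopologicalSpace X]
    [TopologicalSpace Y] [TopologicalSpace Z] {a : X → Y} {b : X → Z} (ha : IsQuotientMap a)
    (hb : IsQuotientMap b) (h : ∀ x x', a x = a x' ↔ b x = b x') :
    ∃ Θ : Y ≃ₜ Z, ∀ x, Θ (a x) = b x := by
  obtain ⟨F, hF⟩ := exists_lift_of_isQuotientMap ha hb.continuous fun x x' => (h x x').1
  obtain ⟨F', hF'⟩ := exists_lift_of_isQuotientMap hb ha.continuous fun x x' => (h x x').2
  refine ⟨⟨⟨F, F', ?_, ?_⟩, F.continuous, F'.continuous⟩, hF⟩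
  · intro y
    obtain ⟨x, rfl⟩ := ha.surjective y
    rw [hF, hF']
  · intro z
    obtain ⟨x, rfl⟩ := hb.surjective z
    rw [hF', hF]

/-- Openness is what makes restriction to an arbitrary subspace of the target possible; it is
applied to the tautological bundle and to a pulled back bundle, both subspaces of products. -/
theorem IsOpenQuotientMap.restrictPreimage {X Y : Type*} [TopologicalSpace X]
    [TopologicalSpace Y] {f : X → Y} (hf : IsOpenQuotientMap f) (s : Set Y) :
    IsOpenQuotientMap (s.restrictPreimage f) where
  surjective := Set.restrictPreimage_surjective s hf.surjective
  continuous := hf.continuous.restrictPreimage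
  isOpenMap := hf.isOpenMap.restrictPreimage s

/-! ### The tautological bundle -/

section Taut

theorem conjHom_injective (hl : 0 < l) (u : unitaryGroup (Fin k × Fin l) ℂ) :
    Function.Injective (conjHom u).toAlgHom := by
  have hu : star (u : MatProd k l) * (u : MatProd k l) = 1 := Unitary.coe_star_mul_self u
  intro a b hab
  rw [conjHom_apply, conjHom_apply] at hab
  have h1 : a ⊗ₖ (1 : Mat l) = b ⊗ₖ (1 : Mat l) := by
    have h2 : ∀ x : MatProd k l, x = star (u : MatProd k l) *
        ((u : MatProd k l) * x * star (u : MatProd k l)) * (u : MatProd k l) := by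
      intro x
      calc x = star (u : MatProd k l) * (u : MatProd k l) * x *
            (star (u : MatProd k l) * (u : MatProd k l)) := by rw [hu, one_mul, mul_one]
        _ = _ := by simp only [mul_assoc]
    rw [h2 (a ⊗ₖ (1 : Mat l)), hab, ← h2]
  ext i j
  simpa [Matrix.kronecker_apply] using congrFun (congrFun h1 (i, ⟨0, hl⟩)) (j, ⟨0, hl⟩)

theorem StarHom.injective (hk : 0 < k) (hl : 0 < l) (h : StarHom k l) :
    Function.Injective h.1.toAlgHom := by
  obtain ⟨u, rfl⟩ := conjStarHom_surjective hk h
  exact conjHom_injective hl u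

theorem mem_taut_iff (hk : 0 < k) {u : unitaryGroup (Fin k × Fin l) ℂ} {T : MatProd k l} :
    (Gr.mk u, T) ∈ Taut k l ↔ ∃ a, (conjHom u).toAlgHom a = T := by
  constructor
  · rintro ⟨u', hu', a, ha⟩
    obtain ⟨g, hg⟩ := (Gr.mk_eq_mk_iff_conjHom hk).1 (show Gr.mk u = Gr.mk u' from hu'.symm)
    refine ⟨g⁻¹ • a, ?_⟩
    rw [← smul_hom_apply, ← hg]
    exact ha.symm
  · rintro ⟨a, rfl⟩
    exact ⟨u, rfl, a, rfl⟩

theorem StarHom.mem_taut (hk : 0 < k) (h : StarHom k l) (a : Mat k) :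
    (StarHom.toGr hk h, h.1.toAlgHom a) ∈ Taut k l := by
  obtain ⟨u, rfl⟩ := conjStarHom_surjective hk h
  rw [StarHom.toGr_conjStarHom, mem_taut_iff hk]
  exact ⟨a, rfl⟩

/-- The evaluation map onto the tautological bundle. -/
def StarHom.toTaut (hk : 0 < k) (p : StarHom k l × Mat k) : Taut k l :=
  ⟨(StarHom.toGr hk p.1, p.1.1.toAlgHom p.2), StarHom.mem_taut hk p.1 p.2⟩

theorem StarHom.isQuotientMap_toTaut (hk : 0 < k) (hl : 0 < l) :
    IsQuotientMap (StarHom.toTaut hk : StarHom k l × Mat k → Taut k l) := by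
  have hc : Continuous (StarHom.toTaut hk : StarHom k l × Mat k → Taut k l) := by
    refine Continuous.subtype_mk (Continuous.prodMk ?_ ?_) _
    · exact (StarHom.isOpenQuotientMap_toGr hk).continuous.comp continuous_fst
    · exact HomSpace.continuous_eval.comp
        ((continuous_subtype_val.comp continuous_fst).prodMk continuous_snd)
  have hq : IsOpenQuotientMap
      (Prod.map (Gr.mk : _ → Gr k l) (id : MatProd k l → MatProd k l)) :=
    Gr.isOpenQuotientMap_mk.prodMap IsOpenQuotientMap.id
  have hr := IsOpenQuotientMap.restrictPreimage hq (Taut k l)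
  -- A continuous lift through the evaluation map: if T = u (a ⊗ E) u*, then u* T u = a ⊗ E, and `a`
  -- is read off from the entries with second index 0. Since the composite is a quotient map, so is
  -- evaluation.
  let m : (Prod.map (Gr.mk : _ → Gr k l) (id : MatProd k l → MatProd k l)) ⁻¹' (Taut k l) →
      StarHom k l × Mat k := fun z => (conjStarHom z.1.1, Matrix.of fun p q =>
    (star (z.1.1 : MatProd k l) * z.1.2 * (z.1.1 : MatProd k l)) (p, ⟨0, hl⟩) (q, ⟨0, hl⟩))
  have hm : Continuous m := by
    refine Continuous.prodMk ?_ (continuous_matrix fun p q => ?_)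
    · exact (continuous_conjHom.subtype_mk _).comp (continuous_fst.comp continuous_subtype_val)
    · have h1 : Continuous fun z : (Prod.map (Gr.mk : _ → Gr k l)
          (id : MatProd k l → MatProd k l)) ⁻¹' (Taut k l) => (z.1.1 : MatProd k l) :=
        continuous_unitary_coe.comp (continuous_fst.comp continuous_subtype_val)
      exact ((h1.star.mul (continuous_snd.comp continuous_subtype_val)).mul h1).matrix_elem _ _
  refine IsQuotientMap.of_comp hm hc ?_
  convert hr.isQuotientMap using 1
  funext z
  obtain ⟨⟨u, T⟩, hz⟩ := z
  obtain ⟨a, rfl⟩ := (mem_taut_iff hk).1 (show (Gr.mk u, T) ∈ Taut k l from hz)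
  have hu : star (u : MatProd k l) * (u : MatProd k l) = 1 := Unitary.coe_star_mul_self u
  have h2 : star (u : MatProd k l) * (conjHom u).toAlgHom a * (u : MatProd k l) =
      a ⊗ₖ (1 : Mat l) := by
    rw [conjHom_apply]
    calc _ = (star (u : MatProd k l) * (u : MatProd k l)) * (a ⊗ₖ (1 : Mat l)) *
          (star (u : MatProd k l) * (u : MatProd k l)) := by simp only [mul_assoc]
      _ = _ := by rw [hu, one_mul, mul_one]
  have h3 : m ⟨(u, (conjHom u).toAlgHom a), hz⟩ = (conjStarHom u, a) := by
    refine Prod.ext rfl ?_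
    ext p q
    change (star (u : MatProd k l) * (conjHom u).toAlgHom a * (u : MatProd k l))
      (p, ⟨0, hl⟩) (q, ⟨0, hl⟩) = a p q
    rw [h2]
    simp
  refine Subtype.ext (Prod.ext ?_ ?_)
  · change StarHom.toGr hk (m _).1 = _
    rw [h3]
    exact StarHom.toGr_conjStarHom hk u
  · change (m _).1.1.toAlgHom (m _).2 = _
    rw [h3]
    rfl

theorem conjHom_nonneg (u : unitaryGroup (Fin k × Fin l) ℂ) {p : Mat k} (hp : 0 ≤ p) :
    0 ≤ (conjHom u).toAlgHom p := by
  have h : (conjHom u).toAlgHom p = star ((conjHom u).toAlgHom (CFC.sqrt p)) *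
      (conjHom u).toAlgHom (CFC.sqrt p) := by
    rw [← isStar_conjHom u, ← map_mul, star_sqrt, CFC.sqrt_mul_sqrt_self p hp]
  rw [h]
  exact star_mul_self_nonneg _

/-- A homomorphism with values in the subalgebra `M_{k,x}` lies over `x`. -/
theorem toGr_toStar_of_mem_taut (hk : 0 < k) (hl : 0 < l) {h : HomSpace k l} {x : Gr k l}
    (hx : ∀ a, (x, h.toAlgHom a) ∈ Taut k l) : StarHom.toGr hk h.toStar = x := by
  obtain ⟨v, rfl⟩ := Gr.mk_surjective x
  set κ := (conjHom v).toAlgHom with hκ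
  have hκs : ∀ a, κ (star a) = star (κ a) := isStar_conjHom v
  -- Factor `h = κ ∘ θ` through the subalgebra M_{k,x}; `θ` need not preserve the involution. As `κ`
  -- does, it commutes with forming `gram`, square roots and inverses, so the deformation never
  -- leaves M_{k,x}.
  let θ : Mat k →ₐ[ℂ] Mat k :=
    ((AlgEquiv.ofInjective κ (conjHom_injective hl v)).symm : κ.range →ₐ[ℂ] Mat k).comp
      (h.toAlgHom.codRestrict κ.range fun a => (mem_taut_iff hk).1 (hx a))
  have hθ : ∀ a, κ (θ a) = h.toAlgHom a := by
    intro a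
    exact congrArg Subtype.val ((AlgEquiv.ofInjective κ (conjHom_injective hl v)).apply_symm_apply
      (h.toAlgHom.codRestrict κ.range (fun a => (mem_taut_iff hk).1 (hx a)) a))
  have hgram : gram h.toAlgHom = κ (gram θ) := by
    simp only [gram, map_sum, map_mul, hκs, hθ]
  have hsqrt : CFC.sqrt (gram h.toAlgHom) = κ (CFC.sqrt (gram θ)) := by
    apply CFC.sqrt_unique
    · rw [← map_mul, CFC.sqrt_mul_sqrt_self _ (gram_nonneg θ), hgram]
    · exact conjHom_nonneg v (CFC.sqrt_nonneg _)
  have hinv : (κ (CFC.sqrt (gram θ)))⁻¹ = κ (CFC.sqrt (gram θ))⁻¹ := by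
    apply Matrix.inv_eq_right_inv
    rw [← map_mul, Matrix.mul_nonsing_inv _ ((Matrix.isUnit_iff_isUnit_det _).1
      (isUnit_sqrt (gram_nonneg θ) (isUnit_gram θ))), map_one]
  have hdef : ∀ a, h.toStar.1.toAlgHom a = κ (FAB.deform θ 1 a) := by
    intro a
    change FAB.deform h.toAlgHom 1 a = _
    rw [deform_apply, deform_apply, interp_one, interp_one, hsqrt, hinv, ← hθ, map_mul, map_mul]
  obtain ⟨w, hw⟩ := conjStarHom_surjective hk h.toStar
  rw [← hw, StarHom.toGr_conjStarHom, eq_comm, Gr.mk_eq_mk_iff]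
  have hv : star (v : MatProd k l) * (v : MatProd k l) = 1 := Unitary.coe_star_mul_self v
  -- Conjugation by v⁻¹w maps M_k ⊗ ℂE_l into itself, which forces v⁻¹w into U(k) ⊗ U(l).
  obtain ⟨a, b, hab⟩ := exists_eq_kroneckerHom hk (v⁻¹ * w) (by
    intro a
    refine ⟨FAB.deform θ 1 a, ?_⟩
    have h1 := hdef a
    rw [← hw] at h1
    change (conjHom w).toAlgHom a = _ at h1
    rw [conjHom_apply, hκ, conjHom_apply] at h1
    have h2 : ((v⁻¹ * w : unitaryGroup (Fin k × Fin l) ℂ) : MatProd k l) =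
      star (v : MatProd k l) * (w : MatProd k l) := rfl
    rw [conjHom_apply, h2, star_mul, star_star]
    calc _ = star (v : MatProd k l) * ((w : MatProd k l) * (a ⊗ₖ (1 : Mat l)) *
          star (w : MatProd k l)) * (v : MatProd k l) := by simp only [mul_assoc]
      _ = (star (v : MatProd k l) * (v : MatProd k l)) * (FAB.deform θ 1 a ⊗ₖ (1 : Mat l)) *
          (star (v : MatProd k l) * (v : MatProd k l)) := by rw [h1]; simp only [mul_assoc]
      _ = _ := by rw [hv, one_mul, mul_one])
  exact ⟨a, b, by rw [← hab, mul_inv_cancel_left]⟩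

end Taut

/-! ### The homotopy equivalence and the classifying maps -/

section Main

variable {E B : Type*} [TopologicalSpace E] [TopologicalSpace B]
  [MulAction (PU (Fin k)) E]

/-- The map `H_{k,l}(A_k^univ) → Gr_{k,l}`, `[e, h] ↦ [h]`. -/
theorem exists_toGr (hk : 0 < k) :
    ∃ φ : C(HUniv k l E, Gr k l), ∀ (e : E) (h : HomSpace k l),
      φ (Assoc.mk (PU (Fin k)) e h) = StarHom.toGr hk h.toStar := by
  have hc : Continuous fun p : E × HomSpace k l => StarHom.toGr hk p.2.toStar :=
    (StarHom.isOpenQuotientMap_toGr hk).continuous.comp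
      (HomSpace.continuous_toStar.comp continuous_snd)
  refine ⟨⟨Quotient.lift (fun p : E × HomSpace k l => StarHom.toGr hk p.2.toStar) ?_,
    hc.quotient_lift _⟩, fun e h => rfl⟩
  rintro p q ⟨g, rfl⟩
  refine ((StarHom.toGr_eq_iff hk).2 ⟨g, ?_⟩).symm
  exact HomSpace.toStar_smul g q.2

/-- The map `Gr_{k,l} → H_{k,l}(A_k^univ)`, `[h] ↦ [f h, h]`, defined by an equivariant map `f`. -/
theorem exists_ofGr (hk : 0 < k) (f : C(StarHom k l, E))
    (hf : ∀ (g : PU (Fin k)) (h h' : StarHom k l), h'.1 = g • h.1 → f h' = g • f h) :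
    ∃ ψ : C(Gr k l, HUniv k l E), ∀ h : StarHom k l,
      ψ (StarHom.toGr hk h) = Assoc.mk (PU (Fin k)) (f h) h.1 := by
  refine exists_lift_of_isQuotientMap (StarHom.isOpenQuotientMap_toGr hk).isQuotientMap
    (f := fun h => Assoc.mk (PU (Fin k)) (f h) h.1) ?_ ?_
  · exact continuous_quotient_mk'.comp (f.continuous.prodMk continuous_subtype_val)
  · intro h h' hh
    obtain ⟨g, hg⟩ := (StarHom.toGr_eq_iff hk).1 hh
    rw [hf g h h' hg, hg, Assoc.mk_smul_smul]

variable {π : C(E, B)}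

/-- The homotopy between `[e, h] ↦ [f h, h]` and the identity. -/
theorem homotopic_id (hk : 0 < k) {ι : Type*} [Finite ι] (hπ : IsUniversalBundle (PU (Fin k)) π)
    (D : FiniteTriv (PU (Fin k)) (StarHom k l) (fun g h h' => h'.1 = g • h.1) ι)
    (f : C(StarHom k l, E))
    (hf : ∀ (g : PU (Fin k)) (h h' : StarHom k l), h'.1 = g • h.1 → f h' = g • f h)
    (φ : C(HUniv k l E, Gr k l)) (hφ : ∀ (e : E) (h : HomSpace k l),
      φ (Assoc.mk (PU (Fin k)) e h) = StarHom.toGr hk h.toStar)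
    (ψ : C(Gr k l, HUniv k l E)) (hψ : ∀ h : StarHom k l,
      ψ (StarHom.toGr hk h) = Assoc.mk (PU (Fin k)) (f h) h.1) :
    (ψ.comp φ).Homotopic (ContinuousMap.id _) := by
  have : ContinuousSMul (PU (Fin k)) E := ⟨hπ.continuous_smul⟩
  have : ContractibleSpace E := hπ.contractible
  let m : C(E × HomSpace k l, StarHom k l) :=
    ⟨fun p => p.2.toStar, HomSpace.continuous_toStar.comp continuous_snd⟩
  obtain ⟨F, hF0, hF1, hFs⟩ := exists_equivariant_homotopy (E := E)
    (D.comap (Rel' := fun g (p p' : E × HomSpace k l) => p' = g • p) m (by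
      rintro g p p' rfl
      exact HomSpace.toStar_smul g p.2)) ⟨Prod.fst, continuous_fst⟩ (f.comp m)
    (by rintro g p p' rfl; rfl)
    (by rintro g p p' rfl; exact hf g _ _ (HomSpace.toStar_smul g p.2))
  -- Openness keeps this a quotient map after multiplying with the interval, so homotopies descend.
  have hq : IsOpenQuotientMap (Prod.map (id : unitInterval → unitInterval)
      (fun p : E × HomSpace k l => Assoc.mk (PU (Fin k)) p.1 p.2)) :=
    IsOpenQuotientMap.id.prodMap Assoc.isOpenQuotientMap_mk
  have hd : Continuous fun z : unitInterval × (E × HomSpace k l) => z.2.2.deform z.1 :=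
    HomSpace.continuous_deform.comp (f := fun z : unitInterval × (E × HomSpace k l) =>
      (z.1, z.2.2)) (by fun_prop)
  have hmk : Continuous fun p : E × HomSpace k l => Assoc.mk (PU (Fin k)) p.1 p.2 :=
    Assoc.isOpenQuotientMap_mk.continuous
  -- The homotopy moves both coordinates at once: `e` to `f h.toStar` along `F`, and `h` to
  -- `h.toStar` along `deform`. Both motions are equivariant, so it descends to classes.
  have hK : Continuous fun z : unitInterval × (E × HomSpace k l) =>
      Assoc.mk (PU (Fin k)) (F z) (z.2.2.deform z.1) :=
    hmk.comp (f := fun z : unitInterval × (E × HomSpace k l) => (F z, z.2.2.deform z.1))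
      (F.continuous.prodMk hd)
  have hfac : ∀ z z' : unitInterval × (E × HomSpace k l),
      Prod.map (id : unitInterval → unitInterval)
        (fun p : E × HomSpace k l => Assoc.mk (PU (Fin k)) p.1 p.2) z =
      Prod.map (id : unitInterval → unitInterval)
        (fun p : E × HomSpace k l => Assoc.mk (PU (Fin k)) p.1 p.2) z' →
      Assoc.mk (PU (Fin k)) (F z) (z.2.2.deform z.1) =
        Assoc.mk (PU (Fin k)) (F z') (z'.2.2.deform z'.1) := by
    rintro ⟨s, e, h⟩ ⟨s', e', h'⟩ heq
    obtain ⟨h1, h2⟩ := Prod.mk.inj heq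
    have h1' : s = s' := h1
    obtain ⟨g, hg1, hg2⟩ := Assoc.mk_eq_mk_iff.1 h2
    have h3 := hFs s g (e', h') (e, h) (Prod.ext hg1.symm hg2.symm)
    have hg2' : g • h' = h := hg2
    subst h1'
    rw [h3, ← hg2', HomSpace.deform_smul, Assoc.mk_smul_smul]
  obtain ⟨H, hH⟩ := exists_lift_of_isQuotientMap hq.isQuotientMap hK hfac
  refine ContinuousMap.Homotopic.symm ⟨⟨H, ?_, ?_⟩⟩
  · intro y
    obtain ⟨⟨e, h⟩, rfl⟩ := Quotient.mk_surjective y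
    refine (hH (0, (e, h))).trans ?_
    change Assoc.mk _ (F (0, (e, h))) (h.deform 0) = Assoc.mk _ e h
    rw [hF0, HomSpace.deform_zero]
    rfl
  · intro y
    obtain ⟨⟨e, h⟩, rfl⟩ := Quotient.mk_surjective y
    refine (hH (1, (e, h))).trans ?_
    change Assoc.mk _ (F (1, (e, h))) (h.deform 1) = ψ (φ (Assoc.mk _ e h))
    rw [hF1, hφ, hψ]
    rfl

/-- The map `[h] ↦ π (f h)` is a classifying map of the tautological bundle. -/
theorem isClassifyingMap_of_equivariant (hk : 0 < k) (hl : 0 < l)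
    (hπ : IsPrincipalBundle (PU (Fin k)) π) (f : C(StarHom k l, E))
    (hf : ∀ (g : PU (Fin k)) (h h' : StarHom k l), h'.1 = g • h.1 → f h' = g • f h)
    (t : C(Gr k l, B)) (ht : ∀ h : StarHom k l, t (StarHom.toGr hk h) = π (f h)) :
    IsClassifyingMap hπ t := by
  have : ContinuousSMul (PU (Fin k)) E := ⟨hπ.continuous_smul⟩
  let P : Set (Gr k l × AUniv k E) := {q | Assoc.proj (Mat k) hπ q.2 = t q.1}
  let α : StarHom k l × Mat k → P := fun p =>
    ⟨(StarHom.toGr hk p.1, Assoc.mk (PU (Fin k)) (f p.1) p.2), (ht p.1).symm⟩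
  have hαc : Continuous α := by
    refine Continuous.subtype_mk (Continuous.prodMk ?_ ?_) _
    · exact (StarHom.isOpenQuotientMap_toGr hk).continuous.comp continuous_fst
    · exact continuous_quotient_mk'.comp ((f.continuous.comp continuous_fst).prodMk continuous_snd)
  have hgr : ∀ (g : PU (Fin k)) (h : StarHom k l),
      StarHom.toGr hk ⟨g • h.1, h.2.smul g⟩ = StarHom.toGr hk h :=
    fun g h => ((StarHom.toGr_eq_iff hk).2 ⟨g, rfl⟩).symm
  have hα : IsQuotientMap α := by
    have hq : IsOpenQuotientMap (Prod.map (StarHom.toGr hk : StarHom k l → Gr k l)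
        (fun p : E × Mat k => Assoc.mk (PU (Fin k)) p.1 p.2)) :=
      (StarHom.isOpenQuotientMap_toGr hk).prodMap Assoc.isOpenQuotientMap_mk
    have hr := IsOpenQuotientMap.restrictPreimage hq P
    set D := Prod.map (StarHom.toGr hk : StarHom k l → Gr k l)
        (fun p : E × Mat k => Assoc.mk (PU (Fin k)) p.1 p.2) ⁻¹' P with hD
    have hDπ : ∀ z : D, π (f z.1.1) = π z.1.2.1 := fun z => by
      have hz : π z.1.2.1 = t (StarHom.toGr hk z.1.1) := z.2
      rw [hz, ht]
    have hc1 : Continuous fun z : D => z.1.1 := continuous_fst.comp continuous_subtype_val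
    have hc2 : Continuous fun z : D => z.1.2.1 :=
      continuous_fst.comp (continuous_snd.comp continuous_subtype_val)
    have hc3 : Continuous fun z : D => z.1.2.2 :=
      continuous_snd.comp (continuous_snd.comp continuous_subtype_val)
    have hctr := hπ.continuous_translation (f.continuous.comp hc1) hc2 hDπ
    -- Given h and [e, a] over the same point, translate h by the element carrying f h to e; this is
    -- a continuous lift through `α`, which is therefore a quotient map.
    let m : D → StarHom k l × Mat k := fun z =>
      (⟨hπ.translation _ _ (hDπ z) • z.1.1.1, z.1.1.2.smul _⟩, z.1.2.2)
    have hm : Continuous m :=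
      (Continuous.subtype_mk (hctr.smul (continuous_subtype_val.comp hc1)) _).prodMk hc3
    refine IsQuotientMap.of_comp hm hαc ?_
    convert hr.isQuotientMap using 1
    funext z
    refine Subtype.ext (Prod.ext (hgr _ _) ?_)
    change Assoc.mk (PU (Fin k)) (f (m z).1) z.1.2.2 = Assoc.mk (PU (Fin k)) z.1.2.1 z.1.2.2
    rw [hf _ z.1.1 (m z).1 rfl, hπ.translation_smul]
  obtain ⟨Θ, hΘ⟩ := exists_homeomorph_of_isQuotientMap hα (StarHom.isQuotientMap_toTaut hk hl) (by
    rintro ⟨h, a⟩ ⟨h', a'⟩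
    rw [Subtype.ext_iff, Subtype.ext_iff, Prod.ext_iff, Prod.ext_iff]
    change (StarHom.toGr hk h = StarHom.toGr hk h' ∧
      Assoc.mk (PU (Fin k)) (f h) a = Assoc.mk (PU (Fin k)) (f h') a') ↔
      (StarHom.toGr hk h = StarHom.toGr hk h' ∧ h.1.toAlgHom a = h'.1.toAlgHom a')
    refine and_congr_right fun hh => ?_
    obtain ⟨g, hg⟩ := (StarHom.toGr_eq_iff hk).1 hh
    -- Over a common base point both relations reduce to a = g⁻¹ a': on one side because PU(k) acts
    -- freely on E, on the other because h is injective.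
    rw [hf g h h' hg, Assoc.mk_smul, hg, smul_hom_apply, (StarHom.injective hk hl h).eq_iff]
    constructor
    · intro heq
      obtain ⟨g', h1, h2⟩ := Assoc.mk_eq_mk_iff.1 heq
      have : g' = 1 := hπ.smul_left_injective (h1.trans (one_smul _ _).symm)
      rw [← h2, this, one_smul]
    · rintro rfl
      rfl)
  refine ⟨Θ, ?_, ?_⟩
  · intro q
    obtain ⟨p, rfl⟩ := hα.surjective q
    have := congrArg (fun z => z.1.1) (hΘ p)
    exact this
  · intro x e he
    obtain ⟨h, rfl⟩ := (StarHom.isOpenQuotientMap_toGr hk).surjective x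
    rw [ht] at he
    have key : f ⟨hπ.translation _ _ he.symm • h.1, h.2.smul _⟩ = e := by
      rw [hf _ h _ rfl, hπ.translation_smul]
    refine ⟨(hπ.translation _ _ he.symm • h.1).toAlgHom, fun a => ?_⟩
    have h1 := congrArg (fun z => z.1.2) (hΘ (⟨hπ.translation _ _ he.symm • h.1, h.2.smul _⟩, a))
    refine Eq.trans ?_ h1
    congr 4
    simp only [key, hgr]

/-- Every classifying map of the tautological bundle is homotopic to `[h] ↦ π (f h)`. -/
theorem IsClassifyingMap.homotopic (hk : 0 < k) (hl : 0 < l) {ι : Type*} [Finite ι]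
    (hπ : IsUniversalBundle (PU (Fin k)) π)
    (D : FiniteTriv (PU (Fin k)) (StarHom k l) (fun g h h' => h'.1 = g • h.1) ι)
    (f : C(StarHom k l, E))
    (hf : ∀ (g : PU (Fin k)) (h h' : StarHom k l), h'.1 = g • h.1 → f h' = g • f h)
    {t₀ t : C(Gr k l, B)} (ht₀ : ∀ h : StarHom k l, t₀ (StarHom.toGr hk h) = π (f h))
    (ht : IsClassifyingMap hπ.toIsPrincipalBundle t) : t₀.Homotopic t := by
  have : ContinuousSMul (PU (Fin k)) E := ⟨hπ.continuous_smul⟩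
  have : ContractibleSpace E := hπ.contractible
  have hπ' := hπ.toIsPrincipalBundle
  obtain ⟨Θ, hΘ1, hΘ2⟩ := ht
  -- This is the pullback t*E. A point (x, e) frames the fibre of the algebra bundle by a ↦ [e, a],
  -- and `Θ` turns the frame into a homomorphism `η` with values in M_{k,x}.
  let Z : Type _ := {z : Gr k l × E // π z.2 = t z.1}
  have hη : ∀ z : Z, ∃ θ : Mat k →ₐ[ℂ] MatProd k l, ∀ a : Mat k,
      (Θ ⟨(z.1.1, Assoc.mk (PU (Fin k)) z.1.2 a), z.2⟩).1.2 = θ a :=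
    fun z => hΘ2 z.1.1 z.1.2 z.2
  choose η' hη' using hη
  let η : Z → HomSpace k l := η'
  have hηa : ∀ (z : Z) (a : Mat k),
      (η z).toAlgHom a = (Θ ⟨(z.1.1, Assoc.mk (PU (Fin k)) z.1.2 a), z.2⟩).1.2 :=
    fun z a => (hη' z a).symm
  have hηc : Continuous η := by
    rw [HomSpace.continuous_iff]
    intro a
    simp only [hηa]
    refine continuous_snd.comp (continuous_subtype_val.comp (Θ.continuous.comp ?_))
    refine Continuous.subtype_mk (Continuous.prodMk ?_ ?_) _
    · exact continuous_fst.comp continuous_subtype_val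
    · exact continuous_quotient_mk'.comp
        ((continuous_snd.comp continuous_subtype_val).prodMk continuous_const)
  let Rel : PU (Fin k) → Z → Z → Prop := fun g z z' => z'.1.1 = z.1.1 ∧ z'.1.2 = g • z.1.2
  have hηs : ∀ g z z', Rel g z z' → η z' = g • η z := by
    rintro g ⟨⟨x, e⟩, hz⟩ ⟨⟨x', e'⟩, hz'⟩ ⟨h1, h2⟩
    simp only at h1 h2
    subst h1 h2
    refine HomSpace.ext fun a => ?_
    rw [smul_hom_apply, hηa, hηa]
    congr 4
    simp only [Assoc.mk_smul]
  -- Since `Θ` is only an algebra isomorphism, `η z` need not be star-preserving; making it so does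
  -- not change the point of the Grassmannian below.
  have hηGr : ∀ z : Z, StarHom.toGr hk (η z).toStar = z.1.1 := by
    intro z
    refine toGr_toStar_of_mem_taut hk hl fun a => ?_
    have h1 := hΘ1 ⟨(z.1.1, Assoc.mk (PU (Fin k)) z.1.2 a), z.2⟩
    have h2 := (Θ ⟨(z.1.1, Assoc.mk (PU (Fin k)) z.1.2 a), z.2⟩).2
    have h3 : (z.1.1, (η z).toAlgHom a) =
        (Θ ⟨(z.1.1, Assoc.mk (PU (Fin k)) z.1.2 a), z.2⟩).1 := Prod.ext h1.symm (hηa z a)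
    rw [h3]
    exact h2
  let m : C(Z, StarHom k l) := ⟨fun z => (η z).toStar, HomSpace.continuous_toStar.comp hηc⟩
  have hms : ∀ g z z', Rel g z z' → (m z').1 = g • (m z).1 := fun g z z' h => by
    change (η z').toStar.1 = g • (η z).toStar.1
    rw [hηs g z z' h, HomSpace.toStar_smul]
  obtain ⟨F, hF0, hF1, hFs⟩ := exists_equivariant_homotopy (E := E) (D.comap (Rel' := Rel) m hms)
    ⟨fun z => z.1.2, continuous_snd.comp continuous_subtype_val⟩ (f.comp m)
    (fun g z z' h => h.2) (fun g z z' h => hf g _ _ (hms g z z' h))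
  -- This choice of fibre points need not be continuous. By `hwd` the value of `H` does not depend
  -- on it, so continuity may be checked with local sections from the trivialisations.
  choose e he using fun x => hπ'.surjective (t x)
  have hwd : ∀ (s : unitInterval) (z z' : Z), z.1.1 = z'.1.1 → π (F (s, z)) = π (F (s, z')) := by
    intro s z z' h
    obtain ⟨g, hg⟩ := hπ'.exists_smul (show π z.1.2 = π z'.1.2 by rw [z.2, z'.2, h])
    rw [hFs s g z z' ⟨h.symm, hg⟩, hπ'.proj_smul]
  let H : unitInterval × Gr k l → B := fun p => π (F (p.1, ⟨(p.2, e p.2), he p.2⟩))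
  have hH : Continuous H := by
    rw [continuous_iff_continuousAt]
    rintro ⟨s, x⟩
    obtain ⟨Φ, hx, -⟩ := hπ'.exists_trivialization (t x)
    let N : Set (Gr k l) := t ⁻¹' Φ.baseSet
    have hN : IsOpen N := Φ.open_baseSet.preimage t.continuous
    let σ : N → Z := fun y =>
      ⟨(y.1, Φ.toOpenPartialHomeomorph.symm (t y.1, 1)), Φ.proj_symm_apply' y.2⟩
    have hσ : Continuous σ := by
      refine Continuous.subtype_mk (continuous_subtype_val.prodMk ?_) _
      refine Φ.continuousOn_invFun.comp_continuous
        ((t.continuous.comp continuous_subtype_val).prodMk continuous_const) fun y => ?_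
      rw [Φ.target_eq]
      exact ⟨y.2, mem_univ _⟩
    have hemb : IsOpenEmbedding
        (Prod.map (id : unitInterval → unitInterval) (Subtype.val : N → Gr k l)) :=
      IsOpenEmbedding.id.prodMap hN.isOpenEmbedding_subtypeVal
    have hcomp : H ∘ Prod.map (id : unitInterval → unitInterval) (Subtype.val : N → Gr k l) =
        fun p => π (F (p.1, σ p.2)) := by
      funext p
      exact hwd _ _ _ rfl
    have h1 : ContinuousAt
        (H ∘ Prod.map (id : unitInterval → unitInterval) (Subtype.val : N → Gr k l))
        (s, ⟨x, hx⟩) := by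
      rw [hcomp]
      exact (π.continuous.comp (F.continuous.comp
        (continuous_fst.prodMk (hσ.comp continuous_snd)))).continuousAt
    exact (hemb.continuousAt_iff (x := (s, (⟨x, hx⟩ : N)))).1 h1
  refine ContinuousMap.Homotopic.symm ⟨⟨⟨H, hH⟩, ?_, ?_⟩⟩
  · intro x
    change π (F (0, _)) = t x
    rw [hF0]
    exact he x
  · intro x
    change π (F (1, _)) = t₀ x
    rw [hF1]
    have h1 := ht₀ (m ⟨(x, e x), he x⟩)
    rw [show StarHom.toGr hk (m ⟨(x, e x), he x⟩) = x from hηGr ⟨(x, e x), he x⟩] at h1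
    exact h1.symm

end Main

end

end FAB

/-! ### Assembly of the homotopy equivalence and comparison with the classifying maps -/

theorem mainTheorem3 (k l : ℕ) (hk : 0 < k) (hl : 0 < l) (hkl : Nat.Coprime k l)
    {E : Type*} {B : Type*} [TopologicalSpace E] [TopologicalSpace B]
    [MulAction (FAB.PU (Fin k)) E] (π : C(E, B))
    (hπ : FAB.IsUniversalBundle (FAB.PU (Fin k)) π) :
    ∃ φ : FAB.HUniv k l E ≃ₕ FAB.Gr k l,
      (∃ t : C(FAB.Gr k l, B), FAB.IsClassifyingMap hπ.toIsPrincipalBundle t) ∧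
      ∀ t : C(FAB.Gr k l, B), FAB.IsClassifyingMap hπ.toIsPrincipalBundle t →
        (t.comp φ.toFun).Homotopic
            (FAB.Assoc.proj (FAB.HomSpace k l) hπ.toIsPrincipalBundle) ∧
          ((FAB.Assoc.proj (FAB.HomSpace k l) hπ.toIsPrincipalBundle).comp φ.invFun).Homotopic
            t := by
  have : ContinuousSMul (FAB.PU (Fin k)) E := ⟨hπ.continuous_smul⟩
  have : ContractibleSpace E := hπ.contractible
  obtain ⟨ι, ⟨D⟩⟩ := FAB.exists_finiteTriv hk hl
  obtain ⟨f, hf⟩ := FAB.exists_equivariant (E := E) D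
  obtain ⟨φ, hφ⟩ := FAB.exists_toGr (k := k) (l := l) (E := E) hk
  obtain ⟨ψ, hψ⟩ := FAB.exists_ofGr hk f hf
  have hψφ := FAB.homotopic_id hk hπ D f hf φ hφ ψ hψ
  -- An equality, not just a homotopy: `toStar` fixes star-preserving homomorphisms.
  have hφψ : φ.comp ψ = ContinuousMap.id _ := by
    ext x
    obtain ⟨h, rfl⟩ := (FAB.StarHom.isOpenQuotientMap_toGr hk).surjective x
    rw [ContinuousMap.comp_apply, hψ, hφ, h.2.toStar_eq, ContinuousMap.id_apply]
  set p := FAB.Assoc.proj (FAB.HomSpace k l) hπ.toIsPrincipalBundle with hp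
  have ht₀ : ∀ h : FAB.StarHom k l, (p.comp ψ) (FAB.StarHom.toGr hk h) = π (f h) := fun h => by
    rw [ContinuousMap.comp_apply, hψ]
    rfl
  refine ⟨⟨φ, ψ, hψφ, hφψ ▸ ContinuousMap.Homotopic.refl _⟩,
    ⟨p.comp ψ, FAB.isClassifyingMap_of_equivariant hk hl hπ.toIsPrincipalBundle f hf _ ht₀⟩,
    fun t ht => ?_⟩
  -- The second homotopy is uniqueness of classifying maps; the first follows by composing with `φ`
  -- and using ψφ ≃ id.
  have h1 : (p.comp ψ).Homotopic t := ht.homotopic hk hl hπ D f hf ht₀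
  refine ⟨?_, h1⟩
  have h2 : (t.comp φ).Homotopic ((p.comp ψ).comp φ) :=
    h1.symm.comp (ContinuousMap.Homotopic.refl φ)
  refine h2.trans ?_
  have h3 : (p.comp (ψ.comp φ)).Homotopic (p.comp (ContinuousMap.id _)) :=
    (ContinuousMap.Homotopic.refl p).comp hψφ
  rwa [ContinuousMap.comp_id] at h3
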